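/- Let $G=(V,E)$ be a finite connected simple undirected graph with diameter $D$. A cut edge is an edge whose deletion disconnects $G$; a cut pair is a set $\{e,f\}$ of two distinct edges whose deletion disconnects $G$ and neither of which is a cut edge; a cut class is an inclusion-maximal set $K\subseteq E$ with $|K|>1$ such that every two distinct elements of $K$ form a cut pair. In the randomized synchronous $\mathcal{CONGEST}$ model every vertex of $G$ runs the same program. Initially a vertex knows only its own ID, the IDs of its neighbours, and whether it is the distinguished leader (exactly one vertex is the leader); the IDs are distinct and have $O(\log |V|)$ bits. In each round every vertex performs an arbitrary local computation, may flip finitely many independent fair coins, and may send to each neighbour one message of $O(\log |V|)$ bits, which is received before the next round. The time is the number of rounds until all vertices have halted; the message complexity is the total number of messages sent. The cut classes are computed if, after halting, there is a partial labelling of the edges such that exactly the edges lying in some cut pair are labelled, the cut classes are exactly the nonempty sets of all edges with a common label, and both endpoints of every edge output its label (or that it has none). Theorem. There are a single randomized $\mathcal{CONGEST}$ program and a constant $C$ such that for every $a$ there is a $B$ (depending only on $a$) with the following property. For every finite connected graph $G=(V,E)$, every leader and every assignment of distinct IDs in $\{0,\dots,2^{a\lceil\log_2|V|\rceil}-1\}$: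 for every outcome of the coin flips, the program halts within $C\cdot D$ rounds, sends at most $C\cdot\min\{|E|\cdot D,\ |V|^2\}$ messages in total, and every message has at most $B\lceil\log_2|V|\rceil$ bits; and with probability at least $1-1/|V|$ it computes all cut classes of $G$. -/

import Mathlib

open MeasureTheory

/-! ### Cut pairs and cut classes -/

namespace SimpleGraph

variable {V : Type*}

/-- A set `F` of edges of `G` is a cut if deleting it leaves a disconnected graph. -/
def IsEdgeCut (G : SimpleGraph V) (F : Set (Sym2 V)) : Prop :=
  F ⊆ G.edgeSet ∧ ¬ (G.deleteEdges F).Connected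

/-- A cut edge is an edge whose deletion leaves a disconnected graph. -/
def IsCutEdge (G : SimpleGraph V) (e : Sym2 V) : Prop :=
  G.IsEdgeCut {e}

/-- A cut pair is a cut consisting of two edges neither of which is a cut edge. -/
def IsCutPair (G : SimpleGraph V) (e f : Sym2 V) : Prop :=
  e ≠ f ∧ G.IsEdgeCut {e, f} ∧ ¬ G.IsCutEdge e ∧ ¬ G.IsCutEdge f

/-- A cut class is an inclusion-maximal set `K` of edges with more than one element, any two of
which form a cut pair. -/
def IsCutClass (G : SimpleGraph V) (K : Set (Sym2 V)) : Prop :=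
  Maximal (fun L : Set (Sym2 V) => L ⊆ G.edgeSet ∧ L.Nontrivial ∧ L.Pairwise G.IsCutPair) K

/-- A partial labelling of the edges represents the cut classes if exactly the edges that lie in
some cut pair carry a label, and the cut classes are exactly the nonempty sets of all edges with
a common label (so that distinct cut classes have distinct labels). -/
def IsCutClassLabelling (G : SimpleGraph V) (lab : Sym2 V → Option ℕ) : Prop :=
  (∀ e ∈ G.edgeSet, (lab e).isSome ↔ ∃ f, G.IsCutPair e f) ∧
  ∀ K : Set (Sym2 V), G.IsCutClass K ↔
    K.Nonempty ∧ ∃ x : ℕ, K = {e | e ∈ G.edgeSet ∧ lab e = some x}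

end SimpleGraph

/-! ### The synchronous message-passing model -/

/-- The program run by every vertex in a randomized synchronous message-passing algorithm.
The same program is used on all networks, and the local computations are unrestricted.
Messages are bit strings; the neighbours of a vertex are addressed by their IDs. -/
structure DistAlg where
  /-- The possible contents of the local memory of a vertex. -/
  State : Type
  /-- The initial state of a vertex, computed from its ID, the set of the IDs of its neighbours,
  and the information whether it is the leader. -/
  init : ℕ → Finset ℕ → Bool → State
  /-- Whether a vertex in the given state has halted. -/
  halted : State → Bool
  /-- The message (if any) that a vertex in the given state sends to the neighbour with the
  given ID. -/
  send : State → ℕ → Option (List Bool)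
  /-- The number of fair coins that a vertex in the given state flips in the current round. -/
  coins : State → ℕ
  /-- The new state, computed from the old one, the messages received (indexed by the ID of the
  sender) and the outcomes of the coin flips. -/
  step : State → (ℕ → Option (List Bool)) → List Bool → State
  /-- The final local output: for each neighbour, given by its ID, the label (if any) of the edge
  to this neighbour. -/
  output : State → ℕ → Option ℕ

namespace DistAlg

/-- The outcomes of all coin flips of all vertices: `ω (v, t, i)` is the `i`-th coin of the
vertex `v` in round `t`. -/
abbrev Coins (V : Type*) : Type _ := V × ℕ × ℕ → Bool

/-- The law of independent fair coins. -/
noncomputable def coinMeasure (V : Type*) : Measure (Coins V) :=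
  Measure.infinitePi fun _ => (PMF.uniformOfFintype Bool).toMeasure

variable {V : Type*} [Fintype V]

open Classical in
/-- The message that `v` sends to `u` when the states of the vertices are given by `s`: only
vertices that have not halted send messages, and only to their neighbours. -/
noncomputable def sent (A : DistAlg) (G : SimpleGraph V) (ident : V → ℕ) (s : V → A.State)
    (v u : V) : Option (List Bool) :=
  if G.Adj v u ∧ A.halted (s v) = false then A.send (s v) (ident u) else none

/-- The messages that `v` receives when the states of the vertices are given by `s`, as a function
of the ID of the sender (there is none for an ID that does not occur). -/
noncomputable def inbox (A : DistAlg) (G : SimpleGraph V) (ident : V → ℕ) (s : V → A.State)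
    (v : V) : ℕ → Option (List Bool) :=
  Function.extend ident (fun u => A.sent G ident s u v) (fun _ => none)

open Classical in
/-- The states of all vertices after `t` rounds of the execution on the network `G` with the IDs
`ident`, the leader `r` and the coin flips `ω`. A halted vertex never changes its state. -/
noncomputable def config (A : DistAlg) (G : SimpleGraph V) (ident : V → ℕ) (r : V)
    (ω : Coins V) : ℕ → V → A.State
  | 0 => fun v =>
      A.init (ident v) ((Finset.univ.filter fun u => G.Adj v u).image ident) (decide (v = r))
  | t + 1 => fun v =>
      let s := config A G ident r ω t
      if A.halted (s v) then s v
      else A.step (s v) (A.inbox G ident s v)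
        (List.ofFn fun i : Fin (A.coins (s v)) => ω (v, t, (i : ℕ)))

/-- The message (if any) that `v` sends to `u` in round `t` (counted from `0`). -/
noncomputable def message (A : DistAlg) (G : SimpleGraph V) (ident : V → ℕ) (r : V)
    (ω : Coins V) (t : ℕ) (v u : V) : Option (List Bool) :=
  A.sent G ident (A.config G ident r ω t) v u

/-- The total number of messages sent in the first `T` rounds. -/
noncomputable def messageCount (A : DistAlg) (G : SimpleGraph V) (ident : V → ℕ) (r : V)
    (ω : Coins V) (T : ℕ) : ℕ :=
  ∑ t ∈ Finset.range T, ∑ v : V, ∑ u : V,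
    if (A.message G ident r ω t v u).isSome then 1 else 0

/-- All vertices have halted after at most `T` rounds. -/
def HaltsWithin (A : DistAlg) (G : SimpleGraph V) (ident : V → ℕ) (r : V)
    (ω : Coins V) (T : ℕ) : Prop :=
  ∀ v, A.halted (A.config G ident r ω T v) = true

/-- After `T` rounds the cut classes are known locally: some labelling of the edges represents the
cut classes, and each vertex outputs the label of each edge incident to it (so that the two ends
of an edge agree on its label). -/
def ComputesCutClasses (A : DistAlg) (G : SimpleGraph V) (ident : V → ℕ) (r : V)
    (ω : Coins V) (T : ℕ) : Prop :=
  ∃ lab : Sym2 V → Option ℕ, G.IsCutClassLabelling lab ∧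
    ∀ v u, G.Adj v u → A.output (A.config G ident r ω T v) (ident u) = lab s(v, u)

end DistAlg

/-! The method is cycle space sampling. Give every edge a vector over `ZMod 2` of length b such that
the values at every vertex sum to zero. Summing these relations over one side of a cut cancels the
edges inside that side, so the values on every edge cut sum to zero (`sum_crossing_eq_zero`). To
sample such a circulation, fix a breadth-first search tree, draw the values of the non-tree edges at
random, and let the tree edge above v carry the sum of the non-tree values met in the subtree of v.
The sum over an edge set F is then a linear form in the random vectors. If F is nonempty and G - F
is connected, some coefficient of the form is 1 (`exists_coeff_eq_one`), so the form vanishes with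
probability at most 2^(-b) (`measure_linear_eq_zero_le`). With b = 5⌈log₂ n⌉, where n = |V|, a union
bound over n^4 pairs of vertex pairs leaves a failure probability of at most 1/n. Outside the
failure event the cut edges are the edges of value zero, and the cut pairs are the pairs of distinct
edges with equal nonzero values (`Generic.isCutPair_iff`). Hence the values themselves label the cut
classes.

What remains is to find out, in time proportional to the height h ≤ D of the tree, which values
occur more than once. Every vertex learns the values of the tree edges on its path to the root,
pipelined down the tree. Let the edge above v form a cut pair with f. If f is a tree edge above or
below it, the lower end of the lower edge sees both values. If f is a non-tree edge, it leaves the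
subtree of v, and its end inside sees both. If f is the edge above some w unrelated to v, then some
non-tree edge leaves the subtree of w, and all such edges end below v, so it suffices to exchange
ancestor lists over non-tree edges (`nonTree_of_unrelated`). To save messages, a vertex sends its
list only to its non-tree neighbours with smallest and largest preorder number: a subtree is an
interval of preorder numbers (`sub_iff_pre`), so if any non-tree edge at a vertex leaves it, one of
these two does (`exists_selected_of_leaving`). Detections are reported up the tree, again pipelined
(`flag_iff`).

Everything takes 6h + 5 rounds. Only three exchanges use all edges, each once per directed edge. The
remaining traffic uses tree edges and selected edges, O(n) of them, in every round; this gives both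
message bounds. The analysis concerns the execution in which nobody halts, where the relevant
messages have closed formulas, and transfers because in a network with at least two vertices all
vertices stop in the same round. -/

namespace CutClasses

/-! ### Encoding of messages -/

/-- A self-delimiting code for bit strings. -/
def delimit (l : List Bool) : List Bool := (l.flatMap fun b => [true, b]) ++ [false]

/-- Each digit is announced by `true` and the end by `false`, so the code is prefix-free and
concatenated codes can be split again. -/
theorem delimit_append_inj {l l' X X' : List Bool} (h : delimit l ++ X = delimit l' ++ X') :
    l = l' ∧ X = X' := by
  induction l generalizing l' with
  | nil =>
    cases l' with
    | nil => simpa [delimit] using h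
    | cons b l' => simp [delimit] at h
  | cons a l ih =>
    cases l' with
    | nil => simp [delimit] at h
    | cons b l' =>
      simp only [delimit, List.flatMap_cons, List.cons_append, List.nil_append,
        List.cons.injEq, true_and] at h
      obtain ⟨h1, h2⟩ := h
      obtain ⟨h3, h4⟩ := ih h2
      exact ⟨by rw [h1, h3], h4⟩

theorem length_delimit (l : List Bool) : (delimit l).length = 2 * l.length + 1 := by
  induction l with
  | nil => simp [delimit]
  | cons a l ih => simp [delimit] at ih ⊢; omega

theorem bits_injective : Function.Injective Nat.bits := by
  intro m
  induction m using Nat.binaryRec' with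
  | zero =>
    intro n h
    have : n.bits.length = 0 := by rw [← h]; simp
    rw [Nat.size_eq_bits_len, Nat.size_eq_zero] at this
    exact this.symm
  | bit b m hb ih =>
    intro n h
    induction n using Nat.binaryRec' with
    | zero =>
      have : (Nat.bit b m).bits.length = 0 := by rw [h]; simp
      rwa [Nat.size_eq_bits_len, Nat.size_eq_zero] at this
    | bit b' n hb' _ =>
      rw [Nat.bits_append_bit _ _ hb, Nat.bits_append_bit _ _ hb'] at h
      simp only [List.cons.injEq] at h
      rw [h.1, ih h.2]

/-- The number of channels on which the layers of the algorithm communicate. -/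
abbrev channels : ℕ := 12

/-- A message consists of at most one number on each channel. -/
abbrev Msg : Type := Fin channels → Option ℕ

/-- The code of an optional number. -/
def optCode (o : Option ℕ) : List Bool := delimit ((o.elim 0 Nat.succ).bits)

theorem optCode_append_inj {o o' : Option ℕ} {X X' : List Bool}
    (h : optCode o ++ X = optCode o' ++ X') : o = o' ∧ X = X' := by
  obtain ⟨h1, h2⟩ := delimit_append_inj h
  refine ⟨?_, h2⟩
  have := bits_injective h1
  cases o <;> cases o' <;> simp_all

theorem flatMap_optCode_injective {l l' : List (Option ℕ)}
    (h : l.flatMap optCode = l'.flatMap optCode) (hl : l.length = l'.length) : l = l' := by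
  induction l generalizing l' with
  | nil => exact (List.length_eq_zero_iff.mp hl.symm).symm
  | cons a l ih =>
    cases l' with
    | nil => simp at hl
    | cons b l' =>
      obtain ⟨h1, h2⟩ := optCode_append_inj h
      rw [h1, ih h2 (by simpa using hl)]

/-- The bit string representing a message. -/
def encode (m : Msg) : List Bool := (List.ofFn m).flatMap optCode

theorem encode_injective : Function.Injective encode := by
  intro m m' h
  exact List.ofFn_injective (flatMap_optCode_injective h (by simp))

theorem length_encode_le {m : Msg} {b : ℕ} (h : ∀ c, ∀ k ∈ m c, k < 2 ^ b) :
    (encode m).length ≤ channels * (2 * (b + 1) + 1) := by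
  have key : ∀ l : List (Option ℕ), (∀ o ∈ l, ∀ k ∈ o, k < 2 ^ b) →
      (l.flatMap optCode).length ≤ l.length * (2 * (b + 1) + 1) := by
    intro l hl
    induction l with
    | nil => simp
    | cons o l ih =>
      have h1 := ih fun o ho => hl o (List.mem_cons_of_mem _ ho)
      have h2 : (optCode o).length ≤ 2 * (b + 1) + 1 := by
        -- The code 0 is reserved for `none`, so `some k` is coded by k + 1, which may equal 2^b and
        -- then needs one digit more.
        have h3 : (o.elim 0 Nat.succ).size ≤ b + 1 := by
          rw [Nat.size_le]
          cases o with
          | none => simp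
          | some k =>
            have := hl (some k) (by simp) k rfl
            simp only [Option.elim, pow_succ]
            omega
        rw [optCode, length_delimit, Nat.size_eq_bits_len]
        omega
      simp only [List.flatMap_cons, List.length_append, List.length_cons]
      linarith
  have := key (List.ofFn m) (by
    intro o ho
    obtain ⟨c, rfl⟩ := (List.mem_ofFn' _ _).mp ho
    exact h c)
  simpa [encode] using this

open Classical in
/-- The bit string sent for a message, if the message is not empty. -/
noncomputable def pack (m : Msg) : Option (List Bool) :=
  if m = fun _ => none then none else some (encode m)

/-- The message received. -/
noncomputable def unpack (o : Option (List Bool)) : Msg :=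
  o.elim (fun _ => none) (Function.invFun encode)

@[simp] theorem unpack_pack (m : Msg) : unpack (pack m) = m := by
  unfold pack unpack
  split_ifs with h
  · simp [h]
  · simp [Function.leftInverse_invFun encode_injective m]

/-! ### Bit vectors -/

/-- The number with the given binary digits. -/
def natOf (b : ℕ) (f : ℕ → ZMod 2) : ℕ := Nat.ofBits fun i : Fin b => decide (f i = 1)

/-- The binary digits of a number. -/
def valOf (k : ℕ) : ℕ → ZMod 2 := fun j => if k.testBit j then 1 else 0

/-- The vectors of length `b`. -/
def vecs (b : ℕ) : AddSubgroup (ℕ → ZMod 2) where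
  carrier := {f | ∀ j, b ≤ j → f j = 0}
  add_mem' := fun hf hg j hj => by simp [hf j hj, hg j hj]
  zero_mem' := fun _ _ => rfl
  neg_mem' := fun hf j hj => by simp [hf j hj]

theorem natOf_lt (b : ℕ) (f : ℕ → ZMod 2) : natOf b f < 2 ^ b := Nat.ofBits_lt_two_pow _

theorem valOf_natOf {b : ℕ} {f : ℕ → ZMod 2} (hf : f ∈ vecs b) : valOf (natOf b f) = f := by
  funext j
  unfold valOf natOf
  by_cases hj : j < b
  · rw [Nat.testBit_ofBits_lt _ _ hj]
    have : f j = 0 ∨ f j = 1 := by generalize f j = x; revert x; decide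
    rcases this with h | h <;> simp [h]
  · rw [Nat.testBit_ofBits_ge _ _ (not_lt.mp hj)]
    simp [hf j (not_lt.mp hj)]

theorem natOf_inj {b : ℕ} {f g : ℕ → ZMod 2} (hf : f ∈ vecs b) (hg : g ∈ vecs b) :
    natOf b f = natOf b g ↔ f = g :=
  ⟨fun h => by rw [← valOf_natOf hf, h, valOf_natOf hg], fun h => by rw [h]⟩

theorem add_self_val (f : ℕ → ZMod 2) : f + f = 0 := by
  funext j; exact CharTwo.add_self_eq_zero _

/-! ### Flipping fair coins -/

section Coins

variable {V : Type*}

instance : IsProbabilityMeasure (DistAlg.coinMeasure V) := by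
  unfold DistAlg.coinMeasure; infer_instance

/-- A fair coin is invariant under negation, and the product measure is mapped coordinatewise. -/
theorem measurePreserving_flip (s : DistAlg.Coins V) :
    MeasurePreserving (fun (ω : DistAlg.Coins V) p => xor (s p) (ω p))
      (DistAlg.coinMeasure V) (DistAlg.coinMeasure V) := by
  refine ⟨by fun_prop, ?_⟩
  unfold DistAlg.coinMeasure
  rw [Measure.infinitePi_map_pi (X := fun _ => Bool) (Y := fun _ => Bool)
    (f := fun p => fun x => xor (s p) x) _ (fun _ => by fun_prop)]
  congr 1
  funext p
  have hinv : Function.Involutive (xor (s p)) := fun x => by cases s p <;> cases x <;> rfl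
  ext A hA
  rw [Measure.map_apply (by fun_prop) hA, PMF.toMeasure_apply_fintype,
    PMF.toMeasure_apply_fintype]
  refine Fintype.sum_equiv hinv.toPerm _ _ fun x => ?_
  simp only [Set.indicator, PMF.uniformOfFintype_apply]
  rfl

/-- A measurable event that is disjoint from its images under the flips indexed by `ι` has
probability at most the inverse of the cardinality of `ι`. -/
theorem measure_mul_card_le {ι : Type*} [Fintype ι] {E : Set (DistAlg.Coins V)}
    (hE : MeasurableSet E) (s : ι → DistAlg.Coins V)
    (hd : Pairwise fun i j => Disjoint {ω : DistAlg.Coins V | (fun p => xor (s i p) (ω p)) ∈ E}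
      {ω : DistAlg.Coins V | (fun p => xor (s j p) (ω p)) ∈ E}) :
    DistAlg.coinMeasure V E * Fintype.card ι ≤ 1 := by
  have h1 : ∑ i : ι, DistAlg.coinMeasure V {ω | (fun p => xor (s i p) (ω p)) ∈ E} ≤ 1 := by
    rw [← tsum_fintype (L := .unconditional _), ← measure_iUnion hd
      fun i => (measurePreserving_flip (s i)).measurable hE]
    exact prob_le_one
  have h2 : ∀ i, DistAlg.coinMeasure V {ω | (fun p => xor (s i p) (ω p)) ∈ E} =
      DistAlg.coinMeasure V E := fun i =>
    (measurePreserving_flip (s i)).measure_preimage hE.nullMeasurableSet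
  simpa [h2, mul_comm] using h1

/-- The vector of length `b` that the vertex `a` reads off its coins in round `S` for the
neighbour with the ID `x`. -/
def coinVec (ω : DistAlg.Coins V) (S b : ℕ) (a : V) (x : ℕ) : ℕ → ZMod 2 :=
  fun j => if j < b ∧ ω (a, S, x * b + j) = true then 1 else 0

theorem coinVec_mem (ω : DistAlg.Coins V) (S b : ℕ) (a : V) (x : ℕ) :
    coinVec ω S b a x ∈ vecs b := fun j hj => by
  simp [coinVec, not_lt.mpr hj]

open Classical in
/-- The pattern that flips the block of coins for the neighbour with the ID `x`. -/
noncomputable def blockFlip (S b : ℕ) (a : V) (x : ℕ) (s : Fin b → Bool) : DistAlg.Coins V :=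
  fun p => if h : p.2.2 - x * b < b then
    (decide (p.1 = a ∧ p.2.1 = S ∧ x * b ≤ p.2.2)) && s ⟨p.2.2 - x * b, h⟩ else false

theorem coinVec_flip_self (ω : DistAlg.Coins V) (S b : ℕ) (a : V) (x : ℕ) (s : Fin b → Bool) :
    coinVec (fun p => xor (blockFlip S b a x s p) (ω p)) S b a x =
      coinVec ω S b a x + fun j => if h : j < b then if s ⟨j, h⟩ then 1 else 0 else 0 := by
  funext j
  by_cases hj : j < b
  · have : blockFlip S b a x s (a, S, x * b + j) = s ⟨j, hj⟩ := by
      simp [blockFlip, hj]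
    simp only [coinVec, this, hj, true_and, Pi.add_apply, dif_pos]
    cases s ⟨j, hj⟩ <;> cases ω (a, S, x * b + j) <;> simp; decide
  · simp [coinVec, hj]

/-- The neighbour with ID x uses the coins with indices in [xb, (x+1)b). These intervals are
disjoint for different x, which makes the random vectors independent. -/
theorem coinVec_flip_of_ne (ω : DistAlg.Coins V) (S b : ℕ) {a a' : V} {x x' : ℕ}
    (s : Fin b → Bool) (h : (a', x') ≠ (a, x)) :
    coinVec (fun p => xor (blockFlip S b a x s p) (ω p)) S b a' x' = coinVec ω S b a' x' := by
  funext j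
  by_cases hj : j < b
  · have : blockFlip S b a x s (a', S, x' * b + j) = false := by
      unfold blockFlip
      split_ifs with h1
      · simp only [Bool.and_eq_false_iff, decide_eq_false_iff_not]
        left
        rintro ⟨rfl, -, h2⟩
        simp only at h1 h2
        apply h
        have h3 : x' = x := by
          rcases lt_trichotomy x x' with h4 | h4 | h4
          · have : (x + 1) * b ≤ x' * b := Nat.mul_le_mul_right _ h4
            rw [add_mul] at this
            omega
          · exact h4.symm
          · have : (x' + 1) * b ≤ x * b := Nat.mul_le_mul_right _ h4
            rw [add_mul] at this
            omega
        rw [h3]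
      · rfl
    simp [coinVec, this]
  · simp [coinVec, hj]

/-- A nonzero linear form in the random vectors vanishes with probability at most `2⁻ᵇ`. -/
theorem measure_linear_eq_zero_le [Fintype V] (S b : ℕ) {ident : V → ℕ} (hid : Function.Injective ident)
    (k : V → V → ZMod 2) {a₀ c₀ : V} (hk : k a₀ c₀ = 1) :
    DistAlg.coinMeasure V {ω | ∑ a, ∑ c, k a c • coinVec ω S b a (ident c) = 0} * 2 ^ b ≤ 1 := by
  classical
  have hm : MeasurableSet {ω : DistAlg.Coins V |
      ∑ a, ∑ c, k a c • coinVec ω S b a (ident c) = 0} := by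
    -- Each coordinate of the form depends on only finitely many coins, so the event is a countable
    -- intersection of cylinder sets.
    have : {ω : DistAlg.Coins V | ∑ a, ∑ c, k a c • coinVec ω S b a (ident c) = 0} =
        ⋂ j : ℕ, (fun ω : DistAlg.Coins V => fun p : V × V => ω (p.1, S, ident p.2 * b + j)) ⁻¹'
          {y | ∑ a, ∑ c, k a c * (if j < b ∧ y (a, c) = true then 1 else 0) = 0} := by
      ext ω
      simp [funext_iff, coinVec]
    rw [this]
    refine MeasurableSet.iInter fun j => ?_
    exact (measurable_pi_lambda _ fun p => measurable_pi_apply _) (Set.toFinite _).measurableSet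
  -- Since the coefficient at (a₀, c₀) is 1, flipping that block by s translates the form by s. The
  -- 2^b flipped events therefore prescribe different values of the form and are pairwise disjoint.
  have key : ∀ (s : Fin b → Bool) (ω : DistAlg.Coins V),
      ∑ a, ∑ c, k a c • coinVec (fun p => xor (blockFlip S b a₀ (ident c₀) s p) (ω p)) S b a
        (ident c) = (∑ a, ∑ c, k a c • coinVec ω S b a (ident c)) +
        fun j => if h : j < b then if s ⟨j, h⟩ then 1 else 0 else 0 := by
    intro s ω
    rw [← Fintype.sum_prod_type', ← Fintype.sum_prod_type',
      ← Finset.add_sum_erase _ _ (Finset.mem_univ (a₀, c₀)),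
      ← Finset.add_sum_erase (Finset.univ : Finset (V × V))
        (fun p => k p.1 p.2 • coinVec ω S b p.1 (ident p.2)) (Finset.mem_univ (a₀, c₀))]
    simp only [coinVec_flip_self, hk, one_smul]
    rw [add_right_comm]
    congr 2
    refine Finset.sum_congr rfl fun p hp => ?_
    rw [coinVec_flip_of_ne]
    intro h
    simp only [Prod.mk.injEq] at h
    exact (Finset.mem_erase.mp hp).1 (Prod.ext h.1 (hid h.2))
  have := measure_mul_card_le hm (fun s : Fin b → Bool => blockFlip S b a₀ (ident c₀) s) ?_
  · simpa using this
  · intro s s' hs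
    rw [Set.disjoint_left]
    intro ω h1 h2
    simp only [Set.mem_ofPred_eq, key] at h1 h2
    have h3 := add_left_cancel (h1.trans h2.symm)
    apply hs
    funext i
    have h4 := congrFun h3 i
    simp only [i.2, dif_pos, Fin.eta] at h4
    revert h4
    cases s i <;> cases s' i <;> simp

/-- The union bound for finitely many linear forms. -/
theorem one_sub_le_measureReal {ι : Type*} [Fintype ι] {E : ι → Set (DistAlg.Coins V)} {b : ℕ}
    (hE : ∀ i, DistAlg.coinMeasure V (E i) * 2 ^ b ≤ 1) {A : Set (DistAlg.Coins V)}
    (hA : ∀ ω, (∀ i, ω ∉ E i) → ω ∈ A) :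
    1 - (Fintype.card ι : ℝ) / 2 ^ b ≤ (DistAlg.coinMeasure V).real A := by
  have h1 : ∀ i, (DistAlg.coinMeasure V).real (E i) ≤ 1 / 2 ^ b := by
    intro i
    rw [le_div_iff₀ (by positivity)]
    have := ENNReal.toReal_mono (by simp) (hE i)
    simpa [ENNReal.toReal_mul, Measure.real] using this
  -- Only subadditivity is applied to this union, so no measurability of A is needed.
  have h2 : (DistAlg.coinMeasure V).real (A ∪ ⋃ i, E i) = 1 := by
    have : A ∪ ⋃ i, E i = Set.univ := by
      rw [Set.eq_univ_iff_forall]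
      intro ω
      by_cases h : ∀ i, ω ∉ E i
      · exact Or.inl (hA ω h)
      · push Not at h
        exact Or.inr (Set.mem_iUnion.mpr h)
    rw [this]; simp
  have h3 := measureReal_union_le (μ := DistAlg.coinMeasure V) A (⋃ i, E i)
  have h4 := measureReal_iUnion_fintype_le (μ := DistAlg.coinMeasure V) E
  have h5 : ∑ i, (DistAlg.coinMeasure V).real (E i) ≤ Fintype.card ι / 2 ^ b := by
    refine (Finset.sum_le_sum fun i _ => h1 i).trans ?_
    simp [div_eq_mul_inv]
  linarith

end Coins

/-! ### Rooted trees -/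

/-- A rooted tree given by its parent function. -/
structure ParentTree (V : Type*) where
  /-- The root. -/
  root : V
  /-- The parent of a vertex; the root is its own parent. -/
  par : V → V
  /-- The depth of a vertex. -/
  dep : V → ℕ
  par_root : par root = root
  dep_root : dep root = 0
  dep_par : ∀ v, v ≠ root → dep (par v) + 1 = dep v

namespace ParentTree

variable {V : Type*} (T : ParentTree V)

/-- `c` is a child of `v`. -/
def Child (v c : V) : Prop := c ≠ T.root ∧ T.par c = v

/-- `u` lies in the subtree of `v`. -/
def Sub (v u : V) : Prop := ∃ k, T.par^[k] u = v

variable {T}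

theorem dep_par_eq (v : V) : T.dep (T.par v) = T.dep v - 1 := by
  by_cases h : v = T.root
  · rw [h, T.par_root, T.dep_root]
  · have := T.dep_par v h; omega

theorem dep_iterate (k : ℕ) (u : V) : T.dep (T.par^[k] u) = T.dep u - k := by
  induction k with
  | zero => rfl
  | succ k ih => rw [Function.iterate_succ_apply', dep_par_eq, ih]; omega

theorem dep_eq_zero {v : V} : T.dep v = 0 ↔ v = T.root := by
  refine ⟨fun h => ?_, fun h => by rw [h, T.dep_root]⟩
  by_contra hv
  have := T.dep_par v hv
  omega

theorem dep_pos {v : V} (h : v ≠ T.root) : 0 < T.dep v :=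
  Nat.pos_of_ne_zero fun h' => h (dep_eq_zero.mp h')

theorem Child.dep_eq {v c : V} (h : T.Child v c) : T.dep c = T.dep v + 1 := by
  rw [← T.dep_par c h.1, h.2]

theorem iterate_dep (u : V) : T.par^[T.dep u] u = T.root := by
  rw [← dep_eq_zero, dep_iterate, Nat.sub_self]

theorem Sub.refl (v : V) : T.Sub v v := ⟨0, rfl⟩

theorem Sub.trans {u v w : V} (h : T.Sub u v) (h' : T.Sub v w) : T.Sub u w := by
  obtain ⟨k, hk⟩ := h
  obtain ⟨l, hl⟩ := h'
  exact ⟨k + l, by rw [Function.iterate_add_apply, hl, hk]⟩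

theorem sub_root (u : V) : T.Sub T.root u := ⟨_, iterate_dep u⟩

theorem sub_iterate (k : ℕ) (u : V) : T.Sub (T.par^[k] u) u := ⟨k, rfl⟩

theorem Child.sub {v c : V} (h : T.Child v c) : T.Sub v c := ⟨1, h.2⟩

theorem Sub.dep_le {v u : V} (h : T.Sub v u) : T.dep v ≤ T.dep u := by
  obtain ⟨k, rfl⟩ := h
  rw [dep_iterate]; omega

theorem Sub.iterate_eq {v u : V} (h : T.Sub v u) : T.par^[T.dep u - T.dep v] u = v := by
  obtain ⟨k, hk⟩ := h
  have h1 := dep_iterate k u (T := T)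
  rw [hk] at h1
  by_cases h2 : k ≤ T.dep u
  · rwa [show T.dep u - T.dep v = k by omega]
  · have h3 : T.dep v = 0 := by omega
    rw [h3, Nat.sub_zero, iterate_dep, dep_eq_zero.mp h3]

theorem Sub.eq_of_dep_eq {v w u : V} (hv : T.Sub v u) (hw : T.Sub w u)
    (h : T.dep v = T.dep w) : v = w := by
  rw [← hv.iterate_eq, ← hw.iterate_eq, h]

theorem Sub.antisymm {v u : V} (h : T.Sub v u) (h' : T.Sub u v) : u = v := by
  have := h.iterate_eq
  rwa [Nat.sub_eq_zero_of_le h'.dep_le] at this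

/-- The ancestors of u form a chain: continuing the climb from u past w reaches v. -/
theorem Sub.of_dep_le {v w u : V} (hv : T.Sub v u) (hw : T.Sub w u) (h : T.dep v ≤ T.dep w) :
    T.Sub v w := by
  have h1 := hv.iterate_eq
  rw [show T.dep u - T.dep v = (T.dep w - T.dep v) + (T.dep u - T.dep w) by
    have := hw.dep_le; omega, Function.iterate_add_apply, hw.iterate_eq] at h1
  exact ⟨_, h1⟩

theorem Sub.total {v w u : V} (hv : T.Sub v u) (hw : T.Sub w u) : T.Sub v w ∨ T.Sub w v :=
  (le_total (T.dep v) (T.dep w)).imp (hv.of_dep_le hw) (hw.of_dep_le hv)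

theorem sub_iff_eq_or_sub_par {v x : V} :
    T.Sub v x ↔ x = v ∨ T.Sub v (T.par x) := by
  constructor
  · rintro ⟨k, hk⟩
    cases k with
    | zero => exact Or.inl hk
    | succ k => exact Or.inr ⟨k, by rwa [Function.iterate_succ_apply] at hk⟩
  · rintro (rfl | h)
    · exact Sub.refl _
    · exact h.trans ⟨1, rfl⟩

theorem not_sub_par_self {x : V} (hx : x ≠ T.root) : ¬ T.Sub x (T.par x) := fun h => by
  have h1 := h.dep_le
  have h2 := T.dep_par x hx
  omega

theorem sub_iff_eq_or_child {v u : V} : T.Sub v u ↔ u = v ∨ ∃ c, T.Child v c ∧ T.Sub c u := by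
  constructor
  · intro h
    by_cases hd : T.dep u ≤ T.dep v
    · left
      have := h.iterate_eq
      rwa [Nat.sub_eq_zero_of_le hd] at this
    · right
      refine ⟨T.par^[T.dep u - T.dep v - 1] u, ⟨?_, ?_⟩, sub_iterate _ _⟩
      · intro h0
        have h1 := dep_iterate (T.dep u - T.dep v - 1) u (T := T)
        rw [h0, T.dep_root] at h1
        omega
      · rw [← Function.iterate_succ_apply' T.par,
          show (T.dep u - T.dep v - 1).succ = T.dep u - T.dep v by omega, h.iterate_eq]
  · rintro (rfl | ⟨c, hc, h⟩)
    · exact Sub.refl _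
    · exact hc.sub.trans h

theorem sub_of_child_ne {v c : V} (hc : T.Child v c) : ¬ T.Sub c v := fun h => by
  have := h.dep_le
  rw [hc.dep_eq] at this
  omega

theorem sum_path [Fintype V] [DecidableEq V] [∀ v u, Decidable (T.Sub v u)]
    {M : Type*} [AddCommMonoid M] (ε : V → M) {x : V} (hx : x ≠ T.root) :
    ∑ v with v ≠ T.root ∧ T.Sub v x, ε v =
      ε x + ∑ v with v ≠ T.root ∧ T.Sub v (T.par x), ε v := by
  have : (Finset.univ.filter fun v => v ≠ T.root ∧ T.Sub v x) =
      insert x (Finset.univ.filter fun v => v ≠ T.root ∧ T.Sub v (T.par x)) := by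
    ext v
    simp only [Finset.mem_filter, Finset.mem_univ, true_and, Finset.mem_insert,
      sub_iff_eq_or_sub_par (x := x)]
    constructor
    · rintro ⟨h1, rfl | h2⟩
      · exact Or.inl rfl
      · exact Or.inr ⟨h1, h2⟩
    · rintro (rfl | ⟨h1, h2⟩)
      · exact ⟨hx, Or.inl rfl⟩
      · exact ⟨h1, Or.inr h2⟩
  rw [this, Finset.sum_insert]
  simp [not_sub_par_self hx]

/-- A property of the vertices is determined by its value at the root and the tree edges along
which it changes. -/
theorem iff_of_changes {S S' : V → Prop} (h0 : S T.root ↔ S' T.root)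
    (h : ∀ x, x ≠ T.root → ((S x ↔ S (T.par x)) ↔ (S' x ↔ S' (T.par x)))) (x : V) :
    S x ↔ S' x := by
  induction hd : T.dep x generalizing x with
  | zero => rwa [dep_eq_zero.mp hd]
  | succ d ih =>
    have hx : x ≠ T.root := fun h' => by rw [h', T.dep_root] at hd; omega
    have h1 := ih (T.par x) (by rw [dep_par_eq]; omega)
    have h2 := h x hx
    tauto

/-- A subtree is entered only through the tree edge above its top vertex. Together with
`iff_of_changes` this identifies the sides of a cut from the tree edges that cross it. -/
theorem sub_changes {v x : V} (hx : x ≠ T.root) :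
    (T.Sub v x ↔ T.Sub v (T.par x)) ↔ x ≠ v := by
  rw [sub_iff_eq_or_sub_par (x := x)]
  constructor
  · rintro h rfl
    exact not_sub_par_self hx (h.mp (Or.inl rfl))
  · intro h
    simp [h]

/-! ### Subtree sums, subtree sizes and preorder intervals. -/

section Sums

open Classical

variable [Fintype V]

/-- The sum of a function over the subtree of `v`, by recursion to the children. -/
theorem sum_sub {M : Type*} [AddCommMonoid M] (f : V → M) (v : V) :
    ∑ u with T.Sub v u, f u = f v + ∑ c with T.Child v c, ∑ u with T.Sub c u, f u := by
  have : (Finset.univ.filter fun u => T.Sub v u) =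
      insert v ((Finset.univ.filter fun c => T.Child v c).biUnion
        fun c => Finset.univ.filter fun u => T.Sub c u) := by
    ext u
    simp only [Finset.mem_filter, Finset.mem_univ, true_and, Finset.mem_insert,
      Finset.mem_biUnion]
    exact sub_iff_eq_or_child
  rw [this, Finset.sum_insert, Finset.sum_biUnion]
  · intro c hc c' hc' hne
    simp only [Finset.coe_filter, Finset.mem_univ, true_and, Set.mem_ofPred_eq] at hc hc'
    refine Finset.disjoint_left.mpr fun u hu hu' => hne ?_
    simp only [Finset.mem_filter, Finset.mem_univ, true_and] at hu hu'
    exact hu.eq_of_dep_eq hu' (by rw [hc.dep_eq, hc'.dep_eq])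
  · simp only [Finset.mem_biUnion, Finset.mem_filter, Finset.mem_univ, true_and, not_exists,
      not_and]
    exact fun c hc => sub_of_child_ne hc

variable (T) in
/-- The number of vertices in the subtree of `v`. -/
noncomputable def size (v : V) : ℕ := (Finset.univ.filter fun u => T.Sub v u).card

theorem size_eq (v : V) : T.size v = 1 + ∑ c with T.Child v c, T.size c := by
  have := sum_sub (T := T) (fun _ => 1) v
  simpa [size] using this

theorem size_pos (v : V) : 0 < T.size v := by rw [size_eq]; omega

theorem size_root : T.size T.root = Fintype.card V := by
  unfold size
  rw [Finset.filter_true_of_mem fun u _ => sub_root u, Finset.card_univ]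

variable (T) in
/-- Auxiliary recursion for `pre`. -/
noncomputable def preAux (key : V → ℕ) : ℕ → V → ℕ
  | 0, _ => 0
  | k + 1, v => preAux key k (T.par v) + 1 +
      ∑ c with T.Child (T.par v) c ∧ key c < key v, T.size c

variable (T) in
/-- The preorder number of a vertex, if siblings are ordered by `key`. -/
noncomputable def pre (key : V → ℕ) (v : V) : ℕ := T.preAux key (T.dep v) v

variable {key : V → ℕ}

theorem pre_root : T.pre key T.root = 0 := by
  rw [pre, T.dep_root, preAux]

theorem pre_child {v c : V} (h : T.Child v c) : T.pre key c = T.pre key v + 1 +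
    ∑ c' with T.Child v c' ∧ key c' < key c, T.size c' := by
  rw [pre, h.dep_eq, preAux, h.2, pre]

theorem Child.pre_lt {v c : V} (h : T.Child v c) : T.pre key v < T.pre key c := by
  rw [pre_child h]; omega

/-- The subtrees of siblings occupy consecutive blocks of numbers: the offset of c' already counts
the whole subtree of c. -/
theorem pre_add_size_le_of_key_lt {v c c' : V} (h : T.Child v c) (h' : T.Child v c')
    (hk : key c < key c') : T.pre key c + T.size c ≤ T.pre key c' := by
  rw [pre_child h, pre_child h', add_assoc, add_comm (∑ _ ∈ _, _) (T.size c)]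
  refine Nat.add_le_add_left ?_ _
  rw [← Finset.sum_insert (a := c) (f := T.size) (by simp)]
  refine Finset.sum_le_sum_of_subset fun x hx => ?_
  simp only [Finset.mem_insert, Finset.mem_filter, Finset.mem_univ, true_and] at hx ⊢
  rcases hx with rfl | ⟨h1, h2⟩
  · exact ⟨h, hk⟩
  · exact ⟨h1, h2.trans hk⟩

theorem Child.pre_add_size_le {v c : V} (h : T.Child v c) :
    T.pre key c + T.size c ≤ T.pre key v + T.size v := by
  rw [pre_child h, size_eq v, add_assoc, add_assoc, add_comm (∑ _ ∈ _, _) (T.size c),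
    ← Finset.sum_insert (a := c) (f := T.size) (by simp)]
  refine Nat.add_le_add_left (Nat.add_le_add_left ?_ _) _
  refine Finset.sum_le_sum_of_subset fun x hx => ?_
  simp only [Finset.mem_insert, Finset.mem_filter, Finset.mem_univ, true_and] at hx ⊢
  rcases hx with rfl | ⟨h1, h2⟩
  · exact h
  · exact h1

theorem Sub.pre_le {v u : V} (h : T.Sub v u) :
    T.pre key v ≤ T.pre key u ∧ T.pre key u + T.size u ≤ T.pre key v + T.size v := by
  obtain ⟨k, rfl⟩ := h
  induction k with
  | zero => exact ⟨le_rfl, le_rfl⟩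
  | succ k ih =>
    rw [Function.iterate_succ_apply']
    by_cases hr : T.par^[k] u = T.root
    · rw [hr, T.par_root]
      rwa [hr] at ih
    · have hc : T.Child (T.par (T.par^[k] u)) (T.par^[k] u) := ⟨hr, rfl⟩
      exact ⟨hc.pre_lt.le.trans ih.1, ih.2.trans hc.pre_add_size_le⟩

theorem pre_lt_card (u : V) : T.pre key u < Fintype.card V := by
  have h := (sub_root (T := T) u).pre_le (key := key)
  rw [pre_root, size_root] at h
  have := size_pos (T := T) u
  omega

/-- Siblings have disjoint blocks. Otherwise the parents are distinct vertices of equal depth, whose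
blocks are disjoint by induction and contain those of u and v. -/
theorem pre_add_size_le_or (hkey : Function.Injective key) {u v : V} (hd : T.dep u = T.dep v)
    (hne : u ≠ v) :
    T.pre key u + T.size u ≤ T.pre key v ∨ T.pre key v + T.size v ≤ T.pre key u := by
  induction h : T.dep u generalizing u v with
  | zero => exact absurd ((dep_eq_zero.mp h).trans (dep_eq_zero.mp (hd ▸ h)).symm) hne
  | succ d ih =>
    have hu : T.Child (T.par u) u := ⟨fun h' => by rw [h', T.dep_root] at h; omega, rfl⟩
    have hv : T.Child (T.par v) v := ⟨fun h' => by rw [hd, h', T.dep_root] at h; omega, rfl⟩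
    by_cases hp : T.par u = T.par v
    · rw [← hp] at hv
      rcases lt_or_gt_of_ne fun h' => hne (hkey h') with h' | h'
      · exact Or.inl (pre_add_size_le_of_key_lt hu hv h')
      · exact Or.inr (pre_add_size_le_of_key_lt hv hu h')
    · have h1 := hu.pre_lt (key := key)
      have h2 := hv.pre_lt (key := key)
      have h3 := hu.pre_add_size_le (key := key)
      have h4 := hv.pre_add_size_le (key := key)
      have h5 := hu.dep_eq
      have h6 := hv.dep_eq
      rcases ih (by omega) hp (by omega) with h' | h'
      · left; omega
      · right; omega

/-- Subtrees are intervals of preorder numbers. -/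
theorem sub_iff_pre (hkey : Function.Injective key) {v u : V} :
    T.Sub v u ↔ T.pre key v ≤ T.pre key u ∧ T.pre key u < T.pre key v + T.size v := by
  constructor
  · intro h
    have h1 := h.pre_le (key := key)
    have h2 := size_pos (T := T) u
    omega
  · rintro ⟨h1, h2⟩
    -- Compare the shallower vertex with the ancestor of the deeper one at the same depth: if they
    -- differ, their blocks are disjoint. If u is a proper ancestor of v, its number is too small.
    rcases le_total (T.dep v) (T.dep u) with hd | hd
    · have hs := sub_iterate (T := T) (T.dep u - T.dep v) u
      by_cases he : T.par^[T.dep u - T.dep v] u = v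
      · exact ⟨_, he⟩
      · have h3 := hs.pre_le (key := key)
        have h4 := size_pos (T := T) u
        have h5 : T.dep (T.par^[T.dep u - T.dep v] u) = T.dep v := by rw [dep_iterate]; omega
        rcases pre_add_size_le_or hkey h5 he with h | h <;> omega
    · have hs := sub_iterate (T := T) (T.dep v - T.dep u) v
      have h3 := hs.pre_le (key := key)
      have h4 := size_pos (T := T) u
      have h6 := size_pos (T := T) v
      have h5 : T.dep (T.par^[T.dep v - T.dep u] v) = T.dep u := by rw [dep_iterate]; omega
      by_cases he : T.par^[T.dep v - T.dep u] v = u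
      · rcases Nat.eq_zero_or_pos (T.dep v - T.dep u) with h0 | h0
        · rw [h0] at he
          rw [← he]
          exact Sub.refl _
        · exfalso
          have hv : v ≠ T.root := fun h => by rw [h, T.dep_root] at h0; omega
          have h7 : T.Sub u (T.par v) :=
            ⟨T.dep v - T.dep u - 1, by
              rw [← Function.iterate_succ_apply T.par,
                show (T.dep v - T.dep u - 1).succ = T.dep v - T.dep u by omega, he]⟩
          have h8 := h7.pre_le (key := key)
          have h9 := Child.pre_lt (key := key) (T := T) ⟨hv, rfl⟩
          omega
      · rcases pre_add_size_le_or hkey h5 he with h | h <;> omega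

theorem pre_injective (hkey : Function.Injective key) : Function.Injective (T.pre key) := by
  intro u v h
  have h1 := size_pos (T := T) u
  have h2 := size_pos (T := T) v
  exact ((sub_iff_pre hkey).mpr ⟨by omega, by omega⟩ : T.Sub v u).antisymm
    ((sub_iff_pre hkey).mpr ⟨by omega, by omega⟩)

end Sums

end ParentTree

open ParentTree

/-! ### Breadth-first search trees -/

/-- `T` is the breadth-first search tree of `G` in which every vertex selects the neighbour with
the smallest ID as its parent. -/
structure IsBfsTree {V : Type*} (G : SimpleGraph V) (ident : V → ℕ) (T : ParentTree V) : Prop where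
  adj_par : ∀ v, v ≠ T.root → G.Adj v (T.par v)
  dep_le : ∀ u v, G.Adj u v → T.dep u ≤ T.dep v + 1
  ident_par_le : ∀ v u, v ≠ T.root → G.Adj v u → T.dep u + 1 = T.dep v →
    ident (T.par v) ≤ ident u

/-- The next vertex on a shortest walk to r is one level lower, so a parent of least ID can be
chosen. The tie-breaking rule determines the parent, so that this tree is the one the vertices find.
-/
theorem exists_isBfsTree {V : Type*} {G : SimpleGraph V} (hG : G.Connected) (ident : V → ℕ)
    (r : V) : ∃ T : ParentTree V, T.root = r ∧ T.dep = G.dist r ∧ IsBfsTree G ident T := by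
  classical
  have h1 : ∀ v, v ≠ r → {u | G.Adj v u ∧ G.dist r u + 1 = G.dist r v}.Nonempty := by
    intro v hv
    obtain ⟨p, hp⟩ := hG.exists_walk_length_eq_dist v r
    cases p with
    | nil => exact absurd rfl hv
    | @cons _ u _ h q =>
      refine ⟨u, h, ?_⟩
      have h2 := G.dist_le q
      have h3 := hG.dist_triangle (u := v) (v := u) (w := r)
      rw [SimpleGraph.dist_eq_one_iff_adj.mpr h] at h3
      rw [SimpleGraph.Walk.length_cons] at hp
      rw [G.dist_comm (u := r), G.dist_comm (u := r)]
      omega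
  refine ⟨⟨r, fun v => if h : v ≠ r then Function.argminOn ident _ (h1 v h) else r, G.dist r,
    by simp, by simp, ?_⟩, rfl, rfl, ?_, ?_, ?_⟩
  · intro v hv
    have := Function.argminOn_mem ident _ (h1 v hv)
    simp only [hv, ne_eq, not_false_eq_true, dif_pos]
    exact this.2
  · intro v hv
    have := Function.argminOn_mem ident _ (h1 v hv)
    simp only at hv
    simp only [hv, ne_eq, not_false_eq_true, dif_pos]
    exact this.1
  · intro u v h
    have h3 := hG.dist_triangle (u := r) (v := v) (w := u)
    rwa [SimpleGraph.dist_eq_one_iff_adj.mpr h.symm] at h3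
  · intro v u hv h hd
    simp only at hv
    simp only [hv, ne_eq, not_false_eq_true, dif_pos]
    exact Function.argminOn_le ident _ (show u ∈ {u | G.Adj v u ∧ G.dist r u + 1 = G.dist r v}
      from ⟨h, hd⟩)

/-! ### Circulations -/

section Circulation

open Classical

variable {V : Type*} {G : SimpleGraph V} {ident : V → ℕ} {T : ParentTree V}

/-- `{a, c}` is an edge of `G` that is not in the tree `T`. -/
def NonTree (G : SimpleGraph V) (T : ParentTree V) (a c : V) : Prop :=
  G.Adj a c ∧ ¬ T.Child c a ∧ ¬ T.Child a c

theorem NonTree.symm {a c : V} (h : NonTree G T a c) : NonTree G T c a :=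
  ⟨h.1.symm, h.2.2, h.2.1⟩

theorem not_child_of_child {v c : V} (h : T.Child v c) : ¬ T.Child c v := fun h' => by
  have h1 := h.dep_eq
  have h2 := h'.dep_eq
  omega

theorem mem_edgeSet_cases {e : Sym2 V} (he : e ∈ G.edgeSet) :
    (∃ v, v ≠ T.root ∧ e = s(v, T.par v)) ∨ ∃ a c, NonTree G T a c ∧ e = s(a, c) := by
  induction e with
  | h a c =>
    by_cases h1 : T.Child c a
    · exact Or.inl ⟨a, h1.1, by rw [h1.2]⟩
    · by_cases h2 : T.Child a c
      · exact Or.inl ⟨c, h2.1, by rw [h2.2, Sym2.eq_swap]⟩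
      · exact Or.inr ⟨a, c, ⟨he, h1, h2⟩, rfl⟩

theorem treeEdge_injective {v w : V} (hv : v ≠ T.root) (hw : w ≠ T.root)
    (h : s(v, T.par v) = s(w, T.par w)) : v = w := by
  rcases Sym2.eq_iff.mp h with ⟨h1, -⟩ | ⟨h1, h2⟩
  · exact h1
  · have h3 := T.dep_par v hv
    have h4 := T.dep_par w hw
    rw [h2] at h3
    rw [← h1] at h4
    omega

theorem NonTree.ne_treeEdge {a c v : V} (h : NonTree G T a c) (hv : v ≠ T.root) :
    s(a, c) ≠ s(v, T.par v) := by
  intro h'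
  rcases Sym2.eq_iff.mp h' with ⟨rfl, h2⟩ | ⟨h1, rfl⟩
  · exact h.2.1 ⟨hv, h2.symm⟩
  · exact h.2.2 ⟨hv, h1.symm⟩

variable [Fintype V]

/-- The value of the tree edge above `v` in the circulation given by the random vectors `R`. -/
noncomputable def up (G : SimpleGraph V) (T : ParentTree V) (R : V → V → ℕ → ZMod 2) (v : V) :
    ℕ → ZMod 2 :=
  ∑ u with T.Sub v u, ∑ w with NonTree G T u w, (R u w + R w u)

theorem up_eq (R : V → V → ℕ → ZMod 2) (v : V) :
    up G T R v = (∑ w with NonTree G T v w, (R v w + R w v)) +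
      ∑ c with T.Child v c, up G T R c :=
  sum_sub _ v

/-- The circulation given by the random vectors `R`, as a function of the ends of an edge. -/
noncomputable def circ (G : SimpleGraph V) (T : ParentTree V) (R : V → V → ℕ → ZMod 2) (v u : V) :
    ℕ → ZMod 2 :=
  if T.Child u v then up G T R v else if T.Child v u then up G T R u else R v u + R u v

variable {R : V → V → ℕ → ZMod 2}

theorem circ_comm (v u : V) : circ G T R v u = circ G T R u v := by
  unfold circ
  by_cases h1 : T.Child u v
  · simp [h1, not_child_of_child h1]
  · by_cases h2 : T.Child v u
    · simp [h1, h2]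
    · simp [h1, h2, add_comm]

theorem circ_of_child {v c : V} (h : T.Child v c) : circ G T R v c = up G T R c := by
  simp [circ, h, not_child_of_child h]

theorem circ_par {v : V} (h : v ≠ T.root) : circ G T R v (T.par v) = up G T R v := by
  rw [circ_comm, circ_of_child ⟨h, rfl⟩]

theorem circ_of_nonTree {a c : V} (h : NonTree G T a c) : circ G T R a c = R a c + R c a := by
  simp [circ, h.2.1, h.2.2]

/-- The circulation given by the random vectors `R`, as a function on the edges. -/
noncomputable def circE (G : SimpleGraph V) (T : ParentTree V) (R : V → V → ℕ → ZMod 2) :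
    Sym2 V → ℕ → ZMod 2 :=
  Sym2.lift ⟨circ G T R, circ_comm⟩

@[simp] theorem circE_mk (v u : V) : circE G T R s(v, u) = circ G T R v u := rfl

theorem up_mem_vecs {b : ℕ} (hR : ∀ u v, R u v ∈ vecs b) (v : V) : up G T R v ∈ vecs b :=
  sum_mem fun _ _ => sum_mem fun _ _ => add_mem (hR _ _) (hR _ _)

theorem circ_mem_vecs {b : ℕ} (hR : ∀ u v, R u v ∈ vecs b) (v u : V) :
    circ G T R v u ∈ vecs b := by
  unfold circ
  split_ifs
  · exact up_mem_vecs hR _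
  · exact up_mem_vecs hR _
  · exact add_mem (hR _ _) (hR _ _)

theorem circE_mem_vecs {b : ℕ} (hR : ∀ u v, R u v ∈ vecs b) (e : Sym2 V) :
    circE G T R e ∈ vecs b := by
  induction e with
  | h v u => exact circ_mem_vecs hR v u

/-- The value above v was defined as the sum of the values on all other edges at v: its non-tree
edges and those to its children. Hence each of these values is counted twice. -/
theorem sum_circ_eq_zero (hT : IsBfsTree G ident T) {v : V} (hv : v ≠ T.root) :
    ∑ u with G.Adj v u, circ G T R v u = 0 := by
  have hs : (Finset.univ.filter fun u => G.Adj v u) = insert (T.par v)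
      ((Finset.univ.filter fun u => NonTree G T v u) ∪ Finset.univ.filter fun u => T.Child v u) := by
    ext u
    simp only [Finset.mem_filter, Finset.mem_univ, true_and, Finset.mem_insert, Finset.mem_union]
    constructor
    · intro h
      by_cases h1 : T.Child u v
      · exact Or.inl h1.2.symm
      · by_cases h2 : T.Child v u
        · exact Or.inr (Or.inr h2)
        · exact Or.inr (Or.inl ⟨h, h1, h2⟩)
    · rintro (rfl | h | h)
      · exact hT.adj_par v hv
      · exact h.1
      · rw [← h.2]
        exact (hT.adj_par u h.1).symm
  rw [hs, Finset.sum_insert, Finset.sum_union, circ_par hv, up_eq,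
    Finset.sum_congr rfl (fun u hu => circ_of_nonTree (Finset.mem_filter.mp hu).2),
    Finset.sum_congr rfl (fun u hu => circ_of_child (Finset.mem_filter.mp hu).2),
    add_self_val]
  · refine Finset.disjoint_left.mpr fun u hu hu' => ?_
    simp only [Finset.mem_filter, Finset.mem_univ, true_and] at hu hu'
    exact hu.2.2 hu'
  · simp only [Finset.mem_union, Finset.mem_filter, Finset.mem_univ, true_and, not_or]
    exact ⟨fun h => h.2.1 ⟨hv, rfl⟩, not_child_of_child ⟨hv, rfl⟩⟩

/-- The circulation vanishes on every edge cut. -/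
theorem sum_crossing_eq_zero (hT : IsBfsTree G ident T) {S : V → Prop} (hS : ¬ S T.root) :
    ∑ p : V × V with S p.1 ∧ ¬ S p.2 ∧ G.Adj p.1 p.2, circ G T R p.1 p.2 = 0 := by
  -- Sum the relations at the vertices of S; the root, where no relation was shown, is not among
  -- them.
  have h1 : ∑ p : V × V with S p.1 ∧ G.Adj p.1 p.2, circ G T R p.1 p.2 = 0 := by
    rw [Finset.sum_filter, ← Finset.univ_product_univ, Finset.sum_product]
    refine Finset.sum_eq_zero fun v _ => ?_
    by_cases hv : S v
    · have := sum_circ_eq_zero hT (v := v) (fun h => hS (h ▸ hv)) (R := R)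
      rw [Finset.sum_filter] at this
      simpa [hv] using this
    · simp [hv]
  -- Edges inside S occur in both directions and cancel.
  have h2 : ∑ p : V × V with S p.1 ∧ S p.2 ∧ G.Adj p.1 p.2, circ G T R p.1 p.2 = 0 := by
    refine Finset.sum_involution (fun p _ => p.swap) ?_ ?_ ?_ ?_
    · intro p _
      simp only [Prod.fst_swap, Prod.snd_swap]
      rw [circ_comm p.2, add_self_val]
    · intro p hp _ h
      simp only [Finset.mem_filter] at hp
      have : p.2 = p.1 := congrArg Prod.fst h
      exact hp.2.2.2.ne this.symm
    · intro p hp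
      simp only [Finset.mem_filter, Finset.mem_univ, true_and, Prod.fst_swap, Prod.snd_swap]
        at hp ⊢
      exact ⟨hp.2.1, hp.1, hp.2.2.symm⟩
    · intro p _
      exact Prod.swap_swap p
  rw [← h1, ← Finset.sum_filter_add_sum_filter_not (Finset.univ.filter fun p : V × V =>
    S p.1 ∧ G.Adj p.1 p.2) (fun p => S p.2), Finset.filter_filter, Finset.filter_filter]
  rw [show (Finset.univ.filter fun p : V × V => (S p.1 ∧ G.Adj p.1 p.2) ∧ S p.2) =
    Finset.univ.filter fun p : V × V => S p.1 ∧ S p.2 ∧ G.Adj p.1 p.2 by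
      ext p; simp only [Finset.mem_filter]; tauto, h2, zero_add]
  refine Finset.sum_congr ?_ fun _ _ => rfl
  ext p; simp only [Finset.mem_filter]; tauto

/-- Orienting each crossing edge out of S matches F with the ordered pairs of
`sum_crossing_eq_zero`. -/
theorem sum_circE_eq_zero (hT : IsBfsTree G ident T) {S : V → Prop} (hS : ¬ S T.root)
    {F : Finset (Sym2 V)} (hF : ↑F ⊆ G.edgeSet)
    (h : ∀ v u, G.Adj v u → (¬ (S v ↔ S u) ↔ s(v, u) ∈ F)) :
    ∑ e ∈ F, circE G T R e = 0 := by
  rw [← sum_crossing_eq_zero hT hS (R := R)]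
  symm
  refine Finset.sum_nbij (fun p => s(p.1, p.2)) ?_ ?_ ?_ ?_
  · intro p hp
    simp only [Finset.mem_filter, Finset.mem_univ, true_and] at hp
    exact (h _ _ hp.2.2).mp fun h' => hp.2.1 (h'.mp hp.1)
  · intro p hp q hq hpq
    simp only [Finset.coe_filter, Finset.mem_univ, true_and, Set.mem_ofPred_eq] at hp hq
    rcases Sym2.eq_iff.mp hpq with ⟨h1, h2⟩ | ⟨h1, h2⟩
    · exact Prod.ext h1 h2
    · exact absurd (h1 ▸ hp.1) hq.2.1
  · intro e he
    induction e with
    | h v u =>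
      have ha : G.Adj v u := hF he
      have h1 := (h v u ha).mpr he
      by_cases hv : S v
      · exact ⟨(v, u), by simp [hv, ha]; tauto, rfl⟩
      · exact ⟨(u, v), by simp [hv, ha.symm]; tauto, Sym2.eq_swap⟩
  · intro p _
    rfl

/-! ### The circulation as a linear form in the random vectors -/

/-- The number of edges of `F` on the path from the root to `x`, modulo two. -/
noncomputable def colour (T : ParentTree V) (F : Finset (Sym2 V)) (x : V) : ZMod 2 :=
  ∑ v with v ≠ T.root ∧ T.Sub v x, if s(v, T.par v) ∈ F then 1 else 0

theorem colour_step (F : Finset (Sym2 V)) {x : V} (hx : x ≠ T.root) :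
    colour T F x = (if s(x, T.par x) ∈ F then 1 else 0) + colour T F (T.par x) :=
  sum_path _ hx

/-- The coefficient of the random vector of `a` for `c` in the sum of the circulation over `F`. -/
noncomputable def coeff (G : SimpleGraph V) (T : ParentTree V) (F : Finset (Sym2 V)) (a c : V) :
    ZMod 2 :=
  if NonTree G T a c then (if s(a, c) ∈ F then 1 else 0) + colour T F a + colour T F c else 0

theorem colour_insert {e : Sym2 V} {F : Finset (Sym2 V)} (he : e ∉ F) (x : V) :
    colour T (insert e F) x = colour T {e} x + colour T F x := by
  unfold colour
  rw [← Finset.sum_add_distrib]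
  refine Finset.sum_congr rfl fun v _ => ?_
  by_cases h : s(v, T.par v) = e
  · subst h; simp [he]
  · simp [h]

theorem coeff_insert {e : Sym2 V} {F : Finset (Sym2 V)} (he : e ∉ F) (a c : V) :
    coeff G T (insert e F) a c = coeff G T {e} a c + coeff G T F a c := by
  unfold coeff
  by_cases hn : NonTree G T a c
  · rw [if_pos hn, if_pos hn, if_pos hn, colour_insert he, colour_insert he]
    by_cases h : s(a, c) = e
    · subst h
      simp only [Finset.mem_insert_self, Finset.mem_singleton_self, he, if_true, if_false]
      ring
    · simp only [Finset.mem_insert, h, Finset.mem_singleton, false_or, if_false]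
      ring
  · simp [hn]

theorem colour_treeEdge {v : V} (hv : v ≠ T.root) (x : V) :
    colour T {s(v, T.par v)} x = if T.Sub v x then 1 else 0 := by
  unfold colour
  have : ∀ w ∈ (Finset.univ.filter fun w => w ≠ T.root ∧ T.Sub w x),
      (if s(w, T.par w) ∈ ({s(v, T.par v)} : Finset (Sym2 V)) then (1 : ZMod 2) else 0) =
      if w = v then 1 else 0 := by
    intro w hw
    simp only [Finset.mem_filter, Finset.mem_univ, true_and] at hw
    congr 1
    simp only [Finset.mem_singleton, eq_iff_iff]
    exact ⟨treeEdge_injective hw.1 hv, fun h => by rw [h]⟩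
  rw [Finset.sum_congr rfl this, Finset.sum_ite_eq']
  simp [hv]

theorem colour_nonTree {a c : V} (h : NonTree G T a c) (x : V) : colour T {s(a, c)} x = 0 := by
  unfold colour
  refine Finset.sum_eq_zero fun w hw => ?_
  simp only [Finset.mem_filter, Finset.mem_univ, true_and] at hw
  simp [(h.ne_treeEdge hw.1).symm]

theorem sum_comm_sub (v : V) (f : V → V → ℕ → ZMod 2) :
    ∑ a, ∑ c, (if T.Sub v a then (1 : ZMod 2) else 0) • f a c =
      ∑ a with T.Sub v a, ∑ c, f a c := by
  rw [Finset.sum_filter]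
  refine Finset.sum_congr rfl fun a _ => ?_
  split_ifs <;> simp

/-- A non-tree edge contributes to the tree edge above v once for each of its ends below v. Modulo
two this counts the edges whose fundamental cycle uses that tree edge. -/
theorem circE_eq_sum {e : Sym2 V} (he : e ∈ G.edgeSet) :
    circE G T R e = ∑ a, ∑ c, coeff G T {e} a c • R a c := by
  rcases mem_edgeSet_cases (T := T) he with ⟨v, hv, rfl⟩ | ⟨a₀, c₀, h, rfl⟩
  · rw [circE_mk, circ_par hv]
    have h1 : ∀ a c, coeff G T {s(v, T.par v)} a c • R a c =
        (if T.Sub v a then (1 : ZMod 2) else 0) • (if NonTree G T a c then R a c else 0) +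
        (if T.Sub v c then (1 : ZMod 2) else 0) • (if NonTree G T c a then R a c else 0) := by
      intro a c
      unfold coeff
      by_cases hn : NonTree G T a c
      · rw [if_pos hn, if_pos hn, if_pos hn.symm, colour_treeEdge hv, colour_treeEdge hv,
          if_neg (by simpa using hn.ne_treeEdge hv), zero_add, add_smul]
      · rw [if_neg hn, if_neg hn, if_neg fun h => hn (NonTree.symm h)]
        simp
    simp only [h1, Finset.sum_add_distrib]
    rw [sum_comm_sub, Finset.sum_comm (f := fun a c => (if T.Sub v c then (1 : ZMod 2) else 0) •
      (if NonTree G T c a then R a c else 0)), sum_comm_sub v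
      (fun c a => if NonTree G T c a then R a c else 0), ← Finset.sum_add_distrib]
    unfold up
    refine Finset.sum_congr rfl fun u _ => ?_
    rw [← Finset.sum_add_distrib, Finset.sum_filter]
    refine Finset.sum_congr rfl fun w _ => ?_
    split_ifs <;> simp
  · rw [circE_mk, circ_of_nonTree h]
    have h1 : ∀ p : V × V, coeff G T {s(a₀, c₀)} p.1 p.2 • R p.1 p.2 =
        (if p ∈ ({(a₀, c₀), (c₀, a₀)} : Finset (V × V)) then R p.1 p.2 else 0) := by
      rintro ⟨a, c⟩
      unfold coeff
      simp only [colour_nonTree h, add_zero]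
      by_cases hac : (a, c) = (a₀, c₀)
      · obtain ⟨rfl, rfl⟩ := Prod.mk.injEq .. ▸ hac
        simp [h]
      · by_cases hac' : (a, c) = (c₀, a₀)
        · obtain ⟨rfl, rfl⟩ := Prod.mk.injEq .. ▸ hac'
          simp [h.symm, Sym2.eq_swap]
        · have : s(a, c) ≠ s(a₀, c₀) := by
            intro h'
            rcases Sym2.eq_iff.mp h' with ⟨rfl, rfl⟩ | ⟨rfl, rfl⟩
            · exact hac rfl
            · exact hac' rfl
          simp [this, hac, hac']
    rw [← Fintype.sum_prod_type', Finset.sum_congr rfl fun p _ => h1 p, Finset.sum_ite_mem,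
      Finset.univ_inter, Finset.sum_pair]
    intro h'
    exact h.1.ne (Prod.mk.injEq .. ▸ h').1

theorem sum_circE_eq_sum {F : Finset (Sym2 V)} (hF : ↑F ⊆ G.edgeSet) :
    ∑ e ∈ F, circE G T R e = ∑ a, ∑ c, coeff G T F a c • R a c := by
  induction F using Finset.induction_on with
  | empty =>
    symm
    rw [Finset.sum_empty]
    refine Finset.sum_eq_zero fun a _ => Finset.sum_eq_zero fun c _ => ?_
    simp [coeff, colour]
  | insert e F he ih =>
    rw [Finset.coe_insert, Set.insert_subset_iff] at hF
    rw [Finset.sum_insert he, ih hF.2, circE_eq_sum hF.1, ← Finset.sum_add_distrib]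
    refine Finset.sum_congr rfl fun a _ => ?_
    rw [← Finset.sum_add_distrib]
    refine Finset.sum_congr rfl fun c _ => ?_
    rw [coeff_insert he, add_smul]

/-- If all coefficients vanished, `colour` would change exactly along the edges of F. It would then
be constant on the connected graph G - F, hence everywhere, although it changes along any element of
F. -/
theorem exists_coeff_eq_one {F : Finset (Sym2 V)}
    (hF : ↑F ⊆ G.edgeSet) (hne : F.Nonempty) (hc : (G.deleteEdges (F : Set (Sym2 V))).Connected) :
    ∃ a c, coeff G T F a c = 1 := by
  by_contra! hno
  have h01 : ∀ x : ZMod 2, x ≠ 1 → x = 0 := by decide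
  have h2 : ∀ x y : ZMod 2, x + y = 0 → x = y := by decide
  have hnon : ∀ a c, NonTree G T a c →
      (if s(a, c) ∈ F then (1 : ZMod 2) else 0) + colour T F a + colour T F c = 0 := by
    intro a c h
    have := h01 _ (hno a c)
    rwa [coeff, if_pos h] at this
  have hstep : ∀ a c, (G.deleteEdges (F : Set (Sym2 V))).Adj a c →
      colour T F a = colour T F c := by
    intro a c h
    rw [SimpleGraph.deleteEdges_adj] at h
    obtain ⟨h, hF'⟩ := h
    simp only [Finset.mem_coe] at hF'
    by_cases h3 : T.Child c a
    · rw [colour_step F h3.1, h3.2, if_neg hF', zero_add]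
    · by_cases h4 : T.Child a c
      · rw [colour_step F h4.1, h4.2, if_neg (by rwa [Sym2.eq_swap]), zero_add]
      · have := hnon a c ⟨h, h3, h4⟩
        rw [if_neg hF', zero_add] at this
        exact h2 _ _ this
  have hconst : ∀ a c, colour T F a = colour T F c := by
    intro a c
    obtain ⟨p⟩ := hc.preconnected a c
    induction p with
    | nil => rfl
    | cons h _ ih => exact (hstep _ _ h).trans ih
  obtain ⟨e, he⟩ := hne
  rcases mem_edgeSet_cases (T := T) (hF he) with ⟨v, hv, rfl⟩ | ⟨a, c, h, rfl⟩
  · have := colour_step F hv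
    rw [if_pos he, hconst v (T.par v)] at this
    simp at this
  · have := hnon a c h
    rw [if_pos he, hconst a c, add_assoc, CharTwo.add_self_eq_zero] at this
    simp at this

end Circulation

/-! ### Cut pairs and the circulation -/

section Cuts

open Classical

variable {V : Type*} {G : SimpleGraph V} {ident : V → ℕ} {T : ParentTree V}

/-- The side consists of the vertices that r no longer reaches. -/
theorem exists_side_of_not_connected {F : Set (Sym2 V)} (h : ¬ (G.deleteEdges F).Connected)
    (r : V) : ∃ S : V → Prop, ¬ S r ∧ (∃ x, S x) ∧
      ∀ v u, G.Adj v u → s(v, u) ∉ F → (S v ↔ S u) := by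
  refine ⟨fun x => ¬ (G.deleteEdges F).Reachable r x, fun h' => h' (.refl r), ?_, ?_⟩
  · by_contra! hall
    have : Nonempty V := ⟨r⟩
    exact h ⟨fun x y => (hall x).symm.trans (hall y)⟩
  · intro v u hvu hF
    have ha : (G.deleteEdges F).Adj v u := by
      rw [SimpleGraph.deleteEdges_adj]; exact ⟨hvu, hF⟩
    exact not_congr ⟨fun h1 => h1.trans ha.reachable, fun h1 => h1.trans ha.symm.reachable⟩

theorem not_connected_of_side {F : Set (Sym2 V)} {S : V → Prop} {r x : V} (hr : ¬ S r) (hx : S x)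
    (h : ∀ v u, G.Adj v u → s(v, u) ∉ F → (S v ↔ S u)) : ¬ (G.deleteEdges F).Connected := by
  intro hc
  obtain ⟨p⟩ := hc.preconnected r x
  have key : ∀ a c, (G.deleteEdges F).Walk a c → (S a ↔ S c) := by
    intro a c p
    induction p with
    | nil => rfl
    | cons h1 _ ih =>
      rw [SimpleGraph.deleteEdges_adj] at h1
      exact (h _ _ h1.1 h1.2).trans ih
  exact hr ((key _ _ p).mpr hx)

theorem not_isCutEdge_of_not_crossing {e : Sym2 V} (he : e ∈ G.edgeSet) {S : V → Prop} {r x : V}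
    (hr : ¬ S r) (hx : S x) (h : ∀ v u, G.Adj v u → s(v, u) ≠ e → (S v ↔ S u)) :
    G.IsCutEdge e :=
  ⟨Set.singleton_subset_iff.mpr he, not_connected_of_side hr hx h⟩

/-- The two sides of a cut pair. -/
theorem exists_side_of_isCutPair {e f : Sym2 V} (h : G.IsCutPair e f) (r : V) :
    ∃ S : V → Prop, ¬ S r ∧ ∀ v u, G.Adj v u → (¬ (S v ↔ S u) ↔ s(v, u) = e ∨ s(v, u) = f) := by
  obtain ⟨-, ⟨hsub, hcut⟩, he, hf⟩ := h
  rw [Set.insert_subset_iff, Set.singleton_subset_iff] at hsub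
  obtain ⟨S, hr, ⟨x, hx⟩, hS⟩ := exists_side_of_not_connected hcut r
  refine ⟨S, hr, fun v u hvu => ⟨fun h1 => ?_, fun h1 => ?_⟩⟩
  · by_contra h2
    exact h1 (hS v u hvu h2)
  -- If one of the two edges did not cross, the other one alone would separate the sides and be a
  -- cut edge.
  · intro h2
    have hall : ∀ v' u', s(v', u') = s(v, u) → (S v' ↔ S u') := by
      intro v' u' h'
      rcases Sym2.eq_iff.mp h' with ⟨rfl, rfl⟩ | ⟨rfl, rfl⟩
      · exact h2
      · exact h2.symm
    rcases h1 with h1 | h1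
    · refine hf (not_isCutEdge_of_not_crossing hsub.2 hr hx fun v' u' hvu' hne => ?_)
      by_cases h3 : s(v', u') = e
      · exact hall _ _ (h3.trans h1.symm)
      · exact hS _ _ hvu' (by simp [h3, hne])
    · refine he (not_isCutEdge_of_not_crossing hsub.1 hr hx fun v' u' hvu' hne => ?_)
      by_cases h3 : s(v', u') = f
      · exact hall _ _ (h3.trans h1.symm)
      · exact hS _ _ hvu' (by simp [h3, hne])

/-- If the cut pairs are the pairs of edges with the same nonzero value, then the values of the
edges in cut pairs label the cut classes. -/
theorem isCutClassLabelling_of_iff {β : Type*} [Zero β] {val : Sym2 V → β}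
    (h : ∀ e f, G.IsCutPair e f ↔ e ≠ f ∧ e ∈ G.edgeSet ∧ f ∈ G.edgeSet ∧ val e = val f ∧ val e ≠ 0)
    {code : β → ℕ} (hcode : ∀ e f, code (val e) = code (val f) → val e = val f)
    {lab : Sym2 V → Option ℕ}
    (hlab : ∀ e x, e ∈ G.edgeSet →
      (lab e = some x ↔ (∃ f, G.IsCutPair e f) ∧ code (val e) = x)) :
    G.IsCutClassLabelling lab := by
  -- A label class is a full value class: once one edge of a value lies in a cut pair, so does every
  -- edge of that value.
  have hK : ∀ e x, e ∈ G.edgeSet → lab e = some x →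
      {e' | e' ∈ G.edgeSet ∧ lab e' = some x} = {e' | e' ∈ G.edgeSet ∧ val e' = val e} := by
    intro e x he hx
    obtain ⟨⟨f, hf⟩, hx⟩ := (hlab e x he).mp hx
    have hf' := (h e f).mp hf
    ext e'
    simp only [Set.mem_ofPred_eq]
    refine and_congr_right fun he' => ?_
    rw [hlab e' x he']
    constructor
    · rintro ⟨-, h1⟩
      exact hcode _ _ (h1.trans hx.symm)
    · intro h1
      refine ⟨?_, by rw [h1, hx]⟩
      by_cases h2 : e' = e
      · exact ⟨f, h2 ▸ hf⟩
      · exact ⟨e, (h _ _).mpr ⟨h2, he', he, h1, h1 ▸ hf'.2.2.2.2⟩⟩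
  refine ⟨fun e he => ?_, fun K => ⟨fun hmax => ?_, ?_⟩⟩
  · rw [Option.isSome_iff_exists]
    simp [hlab e _ he]
  · obtain ⟨⟨hKE, ⟨e, he, f, hf, hef⟩, hpair⟩, hm⟩ := hmax
    have hp := hpair he hf hef
    refine ⟨⟨e, he⟩, code (val e), ?_⟩
    rw [hK e _ (hKE he) ((hlab e _ (hKE he)).mpr ⟨⟨f, hp⟩, rfl⟩)]
    have hp' := (h _ _).mp hp
    -- A cut class lies in one value class, and that value class itself consists of pairwise cut
    -- pairs, so maximality gives equality.
    have hle : K ⊆ {e' | e' ∈ G.edgeSet ∧ val e' = val e} := by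
      intro e' he'
      by_cases h1 : e' = e
      · subst h1; exact ⟨hKE he, rfl⟩
      · exact ⟨hKE he', ((h _ _).mp (hpair he' he h1)).2.2.2.1⟩
    refine hle.antisymm (hm ⟨fun _ h1 => h1.1, ⟨e, hle he, f, hle hf, hef⟩, ?_⟩ hle)
    intro a ha c hc hac
    exact (h _ _).mpr ⟨hac, ha.1, hc.1, ha.2.trans hc.2.symm, ha.2 ▸ hp'.2.2.2.2⟩
  · rintro ⟨⟨e, he⟩, x, rfl⟩
    have he' : _ ∧ _ := he
    obtain ⟨heE, hx⟩ := he'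
    rw [hK e x heE hx]
    obtain ⟨⟨f, hf⟩, -⟩ := (hlab e x heE).mp hx
    have hf' := (h _ _).mp hf
    refine ⟨⟨fun _ h1 => h1.1, ⟨e, ⟨heE, rfl⟩, f, ⟨hf'.2.2.1, hf'.2.2.2.1.symm⟩, hf'.1⟩, ?_⟩, ?_⟩
    · intro a ha c hc hac
      exact (h _ _).mpr ⟨hac, ha.1, hc.1, ha.2.trans hc.2.symm, ha.2 ▸ hf'.2.2.2.2⟩
    · rintro L ⟨hLE, -, hL⟩ hle e' he'
      by_cases h1 : e' = e
      · subst h1; exact ⟨heE, rfl⟩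
      · exact ⟨hLE he', ((h _ _).mp (hL he' (hle ⟨heE, rfl⟩) h1)).2.2.2.1⟩

/-- A non-tree edge in a cut pair: the other edge is a tree edge above one of its ends. -/
theorem exists_ancestor_of_nonTree {a c : V} (hac : NonTree G T a c) (hT : IsBfsTree G ident T)
    {f : Sym2 V} (h : G.IsCutPair s(a, c) f) :
    ∃ v, v ≠ T.root ∧ f = s(v, T.par v) ∧ ¬ (T.Sub v a ↔ T.Sub v c) := by
  obtain ⟨S, hr, hS⟩ := exists_side_of_isCutPair h T.root
  have hf : f ∈ G.edgeSet := h.2.1.1 (by simp)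
  have h1 := (hS a c hac.1).mpr (Or.inl rfl)
  rcases mem_edgeSet_cases (T := T) hf with ⟨v, hv, rfl⟩ | ⟨a', c', h', rfl⟩
  · refine ⟨v, hv, rfl, ?_⟩
    -- The edge above v is the only tree edge that crosses the cut, so the side away from the root
    -- is the subtree of v.
    have : ∀ x, S x ↔ T.Sub v x := by
      refine iff_of_changes (T := T) ?_ fun x hx => ?_
      · simp only [hr, false_iff]
        exact fun h2 => hv (h2.antisymm (sub_root v)).symm
      · rw [sub_changes hx, ← not_iff_not, hS _ _ (hT.adj_par x hx)]
        constructor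
        · rintro (h2 | h2)
          · exact absurd h2.symm (hac.ne_treeEdge hx)
          · exact not_not.mpr (treeEdge_injective hx hv h2)
        · intro h2
          rw [not_not.mp h2]
          exact Or.inr rfl
    rwa [← this, ← this]
  · exfalso
    -- With two non-tree edges no tree edge would cross, so the side would be empty.
    have : ∀ x, S x ↔ False := by
      refine iff_of_changes (T := T) (by simpa using hr) fun x hx => ?_
      rw [← not_iff_not, hS _ _ (hT.adj_par x hx)]
      simp [(hac.ne_treeEdge hx).symm, (h'.ne_treeEdge hx).symm]
    exact h1 (by rw [this, this])

/-- Two tree edges in a cut pair, neither of them above the other: some non-tree edge leaves the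
lower part of the one, and every such edge ends in the lower part of the other. -/
theorem nonTree_of_unrelated {v w : V} (hT : IsBfsTree G ident T) (hv : v ≠ T.root)
    (hw : w ≠ T.root) (h : G.IsCutPair s(v, T.par v) s(w, T.par w)) (hvw : ¬ T.Sub v w)
    (hwv : ¬ T.Sub w v) :
    (∃ a c, NonTree G T a c ∧ T.Sub w a ∧ ¬ T.Sub w c) ∧
    ∀ a c, NonTree G T a c → T.Sub w a → ¬ T.Sub w c → T.Sub v c := by
  have hne : v ≠ w := fun h' => hvw (h' ▸ Sub.refl v)
  have hroot : ∀ x, x ≠ T.root → ¬ T.Sub x T.root := fun x hx h2 =>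
    hx (h2.antisymm (sub_root x)).symm
  obtain ⟨S, hr, hS⟩ := exists_side_of_isCutPair h T.root
  have hdisj : ∀ x, ¬ (T.Sub v x ∧ T.Sub w x) := fun x hx =>
    (hx.1.total hx.2).elim hvw hwv
  -- The crossing tree edges are those above v and w, and the two subtrees are disjoint. Every other
  -- edge leaving one subtree must therefore enter the other.
  have key : ∀ x, S x ↔ (T.Sub v x ∨ T.Sub w x) := by
    refine iff_of_changes (T := T) ?_ fun x hx => ?_
    · simp [hr, hroot v hv, hroot w hw]
    · have h1 := sub_changes (T := T) (v := v) hx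
      have h2 := sub_changes (T := T) (v := w) hx
      have h3 := hdisj x
      have h4 := hdisj (T.par x)
      have h5 := hS _ _ (hT.adj_par x hx)
      have h6 : s(x, T.par x) = s(v, T.par v) ↔ x = v :=
        ⟨treeEdge_injective hx hv, fun h' => by rw [h']⟩
      have h7 : s(x, T.par x) = s(w, T.par w) ↔ x = w :=
        ⟨treeEdge_injective hx hw, fun h' => by rw [h']⟩
      rw [h6, h7] at h5
      by_cases hxv : x = v
      · subst hxv
        have h8 : ¬ T.Sub w (T.par x) := fun h' => hwv ((h2.mpr hne).mpr h')
        simp only [true_or, iff_true] at h5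
        simp [h5, Sub.refl, not_sub_par_self hx, h8]
      · by_cases hxw : x = w
        · subst hxw
          have h8 : ¬ T.Sub v (T.par x) := fun h' => hvw ((h1.mpr hxv).mpr h')
          simp only [or_true, iff_true] at h5
          simp [h5, Sub.refl, not_sub_par_self hx, h8]
        · simp only [hxv, hxw, or_self, iff_false, not_not] at h5
          simp [h5, h1.mpr hxv, h2.mpr hxw]
  refine ⟨?_, fun a c hac ha hc => ?_⟩
  -- Without such a non-tree edge, the tree edge above w would be a cut edge.
  · by_contra! hno
    refine h.2.2.2 (not_isCutEdge_of_not_crossing (hT.adj_par w hw) (S := T.Sub w)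
      (hroot w hw) (Sub.refl w) fun a c hac hne' => ?_)
    by_cases h1 : T.Child c a
    · have := sub_changes (T := T) (v := w) h1.1
      rw [h1.2] at this
      refine this.mpr ?_
      rintro rfl
      exact hne' (by rw [h1.2])
    · by_cases h2 : T.Child a c
      · have := sub_changes (T := T) (v := w) h2.1
        rw [h2.2] at this
        refine (this.mpr ?_).symm
        rintro rfl
        exact hne' (by rw [h2.2, Sym2.eq_swap])
      · exact ⟨hno a c ⟨hac, h1, h2⟩, hno c a ⟨hac.symm, h2, h1⟩⟩
  · have h1 := hS a c hac.1
    simp only [hac.ne_treeEdge hv, hac.ne_treeEdge hw, or_self, iff_false, not_not] at h1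
    rw [key, key] at h1
    tauto

variable [Fintype V] {R : V → V → ℕ → ZMod 2}

/-- The random vectors `R` are generic if the circulation distinguishes all edge sets with at most
two elements that are not cuts from the cuts. -/
def Generic (G : SimpleGraph V) (T : ParentTree V) (R : V → V → ℕ → ZMod 2) : Prop :=
  ∀ e ∈ G.edgeSet, ∀ f ∈ G.edgeSet, (G.deleteEdges {e, f}).Connected →
    ∑ x ∈ ({e, f} : Finset (Sym2 V)), circE G T R x ≠ 0

theorem circE_eq_zero_of_isCutEdge (hG : G.Connected) (hT : IsBfsTree G ident T) {e : Sym2 V}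
    (h : G.IsCutEdge e) : circE G T R e = 0 := by
  obtain ⟨hsub, hcut⟩ := h
  rw [Set.singleton_subset_iff] at hsub
  obtain ⟨S, hr, ⟨x, hx⟩, hS⟩ := exists_side_of_not_connected hcut T.root
  -- If e did not cross, the two sides would already be separated in the connected graph G.
  have hcross : ¬ ∀ v u, s(v, u) = e → (S v ↔ S u) := by
    intro hno
    have := not_connected_of_side (G := G) (F := ∅) hr hx fun v u hvu _ => by
      by_cases h3 : s(v, u) = e
      · exact hno _ _ h3
      · exact hS _ _ hvu (by simpa using h3)
    rw [SimpleGraph.deleteEdges_empty] at this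
    exact this hG
  have := sum_circE_eq_zero hT hr (F := {e}) (by simpa using hsub) (R := R) fun v u hvu => by
    rw [Finset.mem_singleton]
    refine ⟨fun h1 => ?_, fun h1 h2 => hcross ?_⟩
    · by_contra h3
      exact h1 (hS v u hvu (by simpa using h3))
    · intro v' u' h'
      rcases Sym2.eq_iff.mp (h'.trans h1.symm) with ⟨rfl, rfl⟩ | ⟨rfl, rfl⟩
      · exact h2
      · exact h2.symm
  simpa using this

theorem circE_eq_of_isCutPair (hT : IsBfsTree G ident T) {e f : Sym2 V} (h : G.IsCutPair e f) :
    circE G T R e = circE G T R f := by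
  obtain ⟨S, hr, hS⟩ := exists_side_of_isCutPair h T.root
  have h1 := sum_circE_eq_zero hT hr (F := {e, f}) (by simpa using h.2.1.1) (R := R)
    fun v u hvu => by simpa using hS v u hvu
  rw [Finset.sum_pair h.1] at h1
  rw [← add_left_inj (circE G T R f), h1, add_self_val]

/-- Genericity is used with f = e, where the pair collapses to a singleton. -/
theorem Generic.circE_ne_zero (hR : Generic G T R) {e : Sym2 V} (he : e ∈ G.edgeSet)
    (h : ¬ G.IsCutEdge e) : circE G T R e ≠ 0 := by
  have h1 : (G.deleteEdges {e}).Connected := by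
    by_contra h2
    exact h ⟨Set.singleton_subset_iff.mpr he, h2⟩
  simpa using hR e he e he (by simpa using h1)

/-- Over `ZMod 2`, equal values mean that the sum over the pair is zero, which genericity allows
only for cuts. A nonzero value excludes cut edges, whose values always vanish. -/
theorem Generic.isCutPair_iff (hR : Generic G T R) (hG : G.Connected) (hT : IsBfsTree G ident T)
    {e f : Sym2 V} : G.IsCutPair e f ↔ e ≠ f ∧ e ∈ G.edgeSet ∧ f ∈ G.edgeSet ∧
      circE G T R e = circE G T R f ∧ circE G T R e ≠ 0 := by
  constructor
  · intro h
    have hsub := h.2.1.1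
    rw [Set.insert_subset_iff, Set.singleton_subset_iff] at hsub
    exact ⟨h.1, hsub.1, hsub.2, circE_eq_of_isCutPair hT h, hR.circE_ne_zero hsub.1 h.2.2.1⟩
  · rintro ⟨hne, he, hf, heq, h0⟩
    refine ⟨hne, ⟨Set.insert_subset he (Set.singleton_subset_iff.mpr hf), fun hc => ?_⟩,
      fun h => h0 (circE_eq_zero_of_isCutEdge hG hT h),
      fun h => h0 (heq.trans (circE_eq_zero_of_isCutEdge hG hT h))⟩
    refine hR e he f hf hc ?_
    rw [Finset.sum_pair hne, heq, add_self_val]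

end Cuts

/-! ### The program -/

/-- The memory of a vertex: what it knows initially, the current round, and everything that it has
received and all coins that it has flipped so far. -/
structure View where
  /-- The IDs of the neighbours. -/
  nbrs : Finset ℕ
  /-- Whether the vertex is the leader. -/
  lead : Bool
  /-- The current round. -/
  t : ℕ
  /-- The message received in a given round from the neighbour with a given ID. -/
  hist : ℕ → ℕ → Msg
  /-- The coins flipped in a given round. -/
  coin : ℕ → List Bool

namespace View

open Classical

variable (s : View)

/-! The breadth-first search, on channel `0`: a vertex at distance `d` from the leader announces
itself in round `d`, and tells each neighbour whether it is the parent. -/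

/-- The rounds in which an announcement was received. -/
def heard : Set ℕ := {q | ∃ y ∈ s.nbrs, (s.hist q y 0).isSome}

/-- The vertex knows its distance from the leader. -/
def known : Prop := s.lead = true ∨ s.heard.Nonempty

/-- The distance from the leader. -/
noncomputable def dist : ℕ := if s.lead = true then 0 else sInf s.heard + 1

/-- The ID of the parent. -/
noncomputable def parId : ℕ := sInf {y | y ∈ s.nbrs ∧ (s.hist (s.dist - 1) y 0).isSome}

/-- `x` is the ID of the parent. -/
def isPar (x : ℕ) : Prop := s.lead = false ∧ x = s.parId

/-- The IDs of the children. -/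
noncomputable def kids : Finset ℕ := s.nbrs.filter fun x => s.hist (s.dist + 1) x 0 = some 1

/-- The announcement sent to `x`. -/
noncomputable def outBfs (x : ℕ) : Option ℕ :=
  if s.known ∧ s.t = s.dist then some (if s.isPar x then 1 else 0) else none

/-! The sizes of the subtrees are sent upwards on channel `1`. -/

/-- All children had reported the sizes of their subtrees before round `q`. -/
def ready (q : ℕ) : Prop :=
  -- The children announce themselves in round `dist` + 1, so the set of children is complete only
  -- from round `dist` + 2 on.
  s.known ∧ s.dist + 2 ≤ q ∧ ∀ x ∈ s.kids, (s.hist (q - 1) x 1).isSome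

/-- The size of the subtree. -/
noncomputable def size : ℕ := 1 + ∑ x ∈ s.kids, (s.hist (s.t - 1) x 1).getD 0

/-- The size reported to `x`. -/
noncomputable def outEcho (x : ℕ) : Option ℕ :=
  if s.isPar x ∧ s.ready s.t then some s.size else none

/-! The number of vertices, the preorder numbers and the height of the tree are sent downwards on
the channels `2`, `3` and `4`. -/

/-- The number of vertices of the network. -/
noncomputable def numV : Option ℕ :=
  if s.lead = true then if s.ready s.t then some s.size else none
  else if s.known then s.hist (s.t - 1) s.parId 2 else none

/-- The height of the tree. -/
noncomputable def height : Option ℕ :=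
  if s.lead = true then
    -- For a tree of height h the root first becomes ready in round 2h + 2, so the clock reveals h.
    if s.ready s.t then some ((sInf {q | s.ready q} - 2) / 2) else none
  else if s.known then s.hist (s.t - 1) s.parId 4 else none

/-- The preorder number of the vertex. -/
noncomputable def number : Option ℕ :=
  if s.lead = true then some 0
  else if s.known then s.hist (s.t - 1) s.parId 3 else none

/-- The vertex has been informed by its parent. -/
def active : Prop := s.numV.isSome

/-- The number of vertices told to `x`. -/
noncomputable def outN (x : ℕ) : Option ℕ := if x ∈ s.kids then s.numV else none

/-- The height of the tree told to `x`. -/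
noncomputable def outH (x : ℕ) : Option ℕ :=
  if x ∈ s.kids ∧ s.active then s.height else none

/-- The preorder number told to `x`. -/
noncomputable def outPre (x : ℕ) : Option ℕ :=
  if x ∈ s.kids ∧ s.active then
    some (s.number.getD 0 + 1 + ∑ y ∈ s.kids with y < x, (s.hist (s.t - 1) y 1).getD 0)
  else none

/-! Random vectors are drawn in round `base`; these and the preorder numbers are exchanged by all
neighbours on the channels `5` and `6`. -/

/-- The height of the tree. -/
noncomputable def ht : ℕ := s.height.getD 0

/-- The length of the random vectors. -/
noncomputable def bits : ℕ := 5 * Nat.clog 2 (s.numV.getD 0)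

/-- The round in which the random vectors are drawn. -/
noncomputable def base : ℕ := 3 * s.ht + 2

/-- The number of coins flipped. -/
noncomputable def coins : ℕ :=
  if s.active ∧ s.t = s.base then s.bits * (s.nbrs.sup id + 1) else 0

/-- The random vector for the neighbour `x`. -/
noncomputable def rnd (x : ℕ) : ℕ → ZMod 2 := fun j =>
  if j < s.bits ∧ (s.coin s.base).getD (x * s.bits + j) false = true then 1 else 0

/-- The preorder number told to all neighbours. -/
noncomputable def outExPre (_x : ℕ) : Option ℕ :=
  if s.active ∧ s.t = s.base + 1 then s.number else none

/-- The random vector told to `x`. -/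
noncomputable def outExVal (x : ℕ) : Option ℕ :=
  if s.active ∧ s.t = s.base + 1 then some (natOf s.bits (s.rnd x)) else none

/-- The edge to `x` is not in the tree. -/
def isNon (x : ℕ) : Prop := x ∈ s.nbrs ∧ ¬ s.isPar x ∧ x ∉ s.kids

/-- The value of the circulation on the non-tree edge to `x`. -/
noncomputable def nonVal (x : ℕ) : ℕ → ZMod 2 :=
  s.rnd x + valOf ((s.hist (s.base + 1) x 6).getD 0)

/-- The preorder number of the neighbour `x`. -/
noncomputable def nonPre (x : ℕ) : ℕ := (s.hist (s.base + 1) x 5).getD 0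

/-! The values of the circulation on the tree edges are computed upwards on channel `7`. -/

/-- The value of the circulation on the edge to the parent. -/
noncomputable def phi : ℕ → ZMod 2 :=
  ∑ x ∈ s.nbrs with s.isNon x, s.nonVal x +
    ∑ x ∈ s.kids, valOf ((s.hist (s.t - 1) x 7).getD 0)

/-- The value of the circulation told to `x`. -/
noncomputable def outUp (x : ℕ) : Option ℕ :=
  if s.active ∧ s.isPar x ∧ s.base + 2 ≤ s.t then some (natOf s.bits s.phi) else none

/-! The preorder numbers and values of the tree edges above a vertex are sent on the channels `8`
and `9` to its children and over at most two non-tree edges. -/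

/-- The list of ancestors is sent to `x` over a non-tree edge. -/
def selected (x : ℕ) : Prop :=
  s.isNon x ∧ ((∀ y, s.isNon y → s.nonPre x ≤ s.nonPre y) ∨
    ∀ y, s.isNon y → s.nonPre y ≤ s.nonPre x)

/-- The round in which the lists of ancestors are started. -/
noncomputable def listRound : ℕ := s.base + 2 + s.ht

/-- The preorder number of the `i`-th ancestor, other than the root. -/
noncomputable def ancPre (i : ℕ) : Option ℕ :=
  if s.lead = true then none
  else if i = 0 then s.number else s.hist (s.listRound + i - 1) s.parId 8

/-- The value of the circulation on the tree edge above the `i`-th ancestor. -/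
noncomputable def ancVal (i : ℕ) : Option ℕ :=
  if s.lead = true then none
  else if i = 0 then some (natOf s.bits s.phi) else s.hist (s.listRound + i - 1) s.parId 9

/-- The entry of the list of ancestors sent to `x` (preorder number). -/
noncomputable def outLstPre (x : ℕ) : Option ℕ :=
  if s.active ∧ s.listRound ≤ s.t ∧ (x ∈ s.kids ∨ s.selected x) then s.ancPre (s.t - s.listRound)
  else none

/-- The entry of the list of ancestors sent to `x` (value). -/
noncomputable def outLstVal (x : ℕ) : Option ℕ :=
  if s.active ∧ s.listRound ≤ s.t ∧ (x ∈ s.kids ∨ s.selected x) then s.ancVal (s.t - s.listRound)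
  else none

/-! Whether an edge lies in a cut pair is reported upwards on channel `10`; finally the labels are
exchanged on channel `11`. -/

/-- The vertex detects that the tree edge above its `i`-th ancestor lies in a cut pair. -/
def detects (i : ℕ) : Prop :=
  ∃ w, w ≠ 0 ∧ s.ancVal i = some w ∧
    ((∃ j, j ≠ i ∧ s.ancVal j = some w) ∨
      (∃ x, s.isNon x ∧ natOf s.bits (s.nonVal x) = w) ∨
      -- Comparing preorder numbers excludes the same tree edge occurring above both ends.
      ∃ x j, s.isNon x ∧ s.hist (s.listRound + j) x 9 = some w ∧
        s.hist (s.listRound + j) x 8 ≠ s.ancPre i)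

/-- The round in which the reports are started. -/
noncomputable def flagRound : ℕ := s.listRound + s.ht

/-- Some vertex in the subtree has detected that the tree edge above the ancestor at depth `k` lies
in a cut pair. -/
def flag (k : ℕ) : Prop :=
  s.detects (s.dist - k) ∨
    -- A child is one level deeper and starts its reports one round earlier, whence the `- 1`.
    ∃ x ∈ s.kids, (s.hist (s.flagRound + (s.ht - s.dist) + k - 1) x 10).isSome

/-- The report to `x`. -/
noncomputable def outFlag (x : ℕ) : Option ℕ :=
  if s.active ∧ s.isPar x ∧ s.flag (s.t - (s.flagRound + (s.ht - s.dist))) then some 0 else none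

/-- The round in which the labels are exchanged. -/
noncomputable def finalRound : ℕ := s.flagRound + s.ht

/-- The label of the edge to `x`, as far as known without the other end. -/
noncomputable def label (x : ℕ) : Option ℕ :=
  if s.isPar x then if s.flag s.dist then some (natOf s.bits s.phi) else none
  else if s.isNon x ∧ natOf s.bits (s.nonVal x) ≠ 0 ∧
    ∃ j, s.ancVal j = some (natOf s.bits (s.nonVal x)) then some (natOf s.bits (s.nonVal x))
  else none

/-- The label told to `x`. -/
noncomputable def outFin (x : ℕ) : Option ℕ :=
  if s.active ∧ s.t = s.finalRound then s.label x else none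

/-- The message sent to `x`. -/
noncomputable def out (x : ℕ) : Msg :=
  ![s.outBfs x, s.outEcho x, s.outN x, s.outPre x, s.outH x, s.outExPre x, s.outExVal x,
    s.outUp x, s.outLstPre x, s.outLstVal x, s.outFlag x, s.outFin x]

/-- The vertex has finished. -/
def finished : Prop := s.nbrs = ∅ ∨ (s.active ∧ s.finalRound < s.t)

/-- The label of the edge to `x`. -/
noncomputable def output (x : ℕ) : Option ℕ := (s.label x).or (s.hist s.finalRound x 11)

end View

/-- The program with an arbitrary halting rule. -/
noncomputable abbrev program (halt : View → Bool) : DistAlg where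
  State := View
  init _ N l := ⟨N, l, 0, fun _ _ _ => none, fun _ => []⟩
  halted := halt
  send s x := pack (s.out x)
  coins := View.coins
  step s inbox cs :=
    { s with
      t := s.t + 1
      hist := fun q => if q = s.t then fun x => unpack (inbox x) else s.hist q
      coin := fun q => if q = s.t then cs else s.coin q }
  output := View.output

open Classical in
/-- The program that computes the cut classes. -/
noncomputable def cutClassProgram : DistAlg := program fun s => decide s.finished

/-! ### Executions without halting -/

section Run

variable {V : Type*} [Fintype V]

/-- The memories of the vertices in an execution in which no vertex halts. -/
noncomputable def run (G : SimpleGraph V) (ident : V → ℕ) (r : V) (ω : DistAlg.Coins V) (t : ℕ)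
    (v : V) : View :=
  (program fun _ => false).config G ident r ω t v

variable {G : SimpleGraph V} {ident : V → ℕ} {r : V} {ω : DistAlg.Coins V} {t q : ℕ} {v u : V}

theorem run_succ : run G ident r ω (t + 1) v =
    (program fun _ => false).step (run G ident r ω t v)
      ((program fun _ => false).inbox G ident (run G ident r ω t) v)
      (List.ofFn fun i : Fin ((run G ident r ω t v).coins) => ω (v, t, (i : ℕ))) := rfl

@[simp] theorem run_t : (run G ident r ω t v).t = t := by
  induction t with
  | zero => rfl
  | succ t ih => rw [run_succ]; simp [ih]

theorem run_nbrs : (run G ident r ω t v).nbrs = (run G ident r ω 0 v).nbrs := by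
  induction t with
  | zero => rfl
  | succ t ih => rw [run_succ, ← ih]

theorem mem_run_nbrs {x : ℕ} :
    x ∈ (run G ident r ω t v).nbrs ↔ ∃ u, G.Adj v u ∧ ident u = x := by
  rw [run_nbrs]
  simp [run, DistAlg.config]

theorem run_lead : (run G ident r ω t v).lead = true ↔ v = r := by
  induction t with
  | zero => simp [run, DistAlg.config]
  | succ t ih => rw [run_succ, ← ih]

theorem run_hist_of_le (h : t ≤ q) : (run G ident r ω t v).hist q = fun _ _ => none := by
  induction t with
  | zero => rfl
  | succ t ih =>
    rw [run_succ]
    simp only [run_t, show q ≠ t by omega, if_false]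
    exact ih (by omega)

theorem run_hist_of_lt (h : q < t) (x : ℕ) : (run G ident r ω t v).hist q x =
    unpack ((program fun _ => false).inbox G ident (run G ident r ω q) v x) := by
  induction t with
  | zero => omega
  | succ t ih =>
    rw [run_succ]
    rcases Nat.lt_succ_iff_lt_or_eq.mp h with h | rfl
    · simp only [run_t, show q ≠ t by omega, if_false]
      exact ih h
    · simp only [run_t, if_true]

/-- As the encoding is injective and IDs are distinct, the record received is the one sent. The
analysis of the computation then works with records instead of bit strings. -/
theorem run_hist (hid : Function.Injective ident) (hq : q < t) (h : G.Adj u v) :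
    (run G ident r ω t v).hist q (ident u) = (run G ident r ω q u).out (ident v) := by
  rw [run_hist_of_lt hq]
  unfold DistAlg.inbox
  rw [hid.extend_apply]
  unfold DistAlg.sent
  rw [if_pos ⟨h, rfl⟩]
  exact unpack_pack _

theorem run_coin (h : q < t) : (run G ident r ω t v).coin q =
    List.ofFn fun i : Fin ((run G ident r ω q v).coins) => ω (v, q, (i : ℕ)) := by
  induction t with
  | zero => omega
  | succ t ih =>
    rw [run_succ]
    rcases Nat.lt_succ_iff_lt_or_eq.mp h with h | rfl
    · simp only [run_t, show q ≠ t by omega, if_false]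
      exact ih h
    · simp only [run_t, if_true]

/-- If no vertex halts before round `E` and all vertices halt in round `E`, then the execution is
the one without halting up to round `E`. -/
theorem config_eq_run {E : ℕ} (halt : View → Bool)
    (h : ∀ q, q < E → ∀ v, halt (run G ident r ω q v) = false) (ht : t ≤ E) :
    (program halt).config G ident r ω t = run G ident r ω t := by
  induction t with
  | zero => rfl
  | succ t ih =>
    have ih := ih (by omega)
    funext v
    have h1 := h t (by omega)
    have h2 : ∀ v, (program halt).halted (run G ident r ω t v) = false := h1
    rw [DistAlg.config, ih, run_succ]
    refine (if_neg ?_).trans ?_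
    · rw [h2 v]; simp
    have h3 : (program halt).inbox G ident (run G ident r ω t) v =
        (program fun _ => false).inbox G ident (run G ident r ω t) v := by
      unfold DistAlg.inbox DistAlg.sent
      congr 1
      funext w
      by_cases hw : G.Adj w v
      · exact (if_pos ⟨hw, h1 w⟩).trans (if_pos ⟨hw, rfl⟩).symm
      · exact (if_neg fun h' => hw h'.1).trans (if_neg fun h' => hw h'.1).symm
    rw [h3]

theorem config_eq_run_end {E : ℕ} (halt : View → Bool)
    (h : ∀ q, q < E → ∀ v, halt (run G ident r ω q v) = false)
    (hE : ∀ v, halt (run G ident r ω E v) = true) (ht : E ≤ t) :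
    (program halt).config G ident r ω t = run G ident r ω E := by
  induction t, ht using Nat.le_induction with
  | base => exact config_eq_run halt h le_rfl
  | succ t _ ih =>
    funext v
    have : (program halt).halted (run G ident r ω E v) = true := hE v
    rw [DistAlg.config, ih]
    exact if_pos this

end Run

/-- The height of a rooted tree. -/
def ParentTree.height {V : Type*} [Fintype V] (T : ParentTree V) : ℕ := Finset.univ.sup T.dep

theorem ParentTree.dep_le_height {V : Type*} [Fintype V] (T : ParentTree V) (v : V) :
    T.dep v ≤ T.height := Finset.le_sup (Finset.mem_univ v)

/-! ### The execution: breadth-first search and the broadcast -/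

section Closed

open Classical

variable {V : Type*} [Fintype V] {G : SimpleGraph V} {ident : V → ℕ} {T : ParentTree V}
  {ω : DistAlg.Coins V} {t q : ℕ} {v u c : V}

local notation "W" => run G ident T.root ω

omit [Fintype V] in
theorem IsBfsTree.adj_of_child (hT : IsBfsTree G ident T) (h : T.Child v c) : G.Adj v c := by
  rw [← h.2]; exact (hT.adj_par c h.1).symm

/-- Depths of neighbours differ by at most one, so the earliest announcement heard comes from depth
`T.dep v - 1`, in particular from the parent. -/
theorem dist_of_heard (hT : IsBfsTree G ident T)
    (h : (W t v).heard = {q | q < t ∧ ∃ u, G.Adj v u ∧ T.dep u = q}) :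
    ((W t v).known ↔ T.dep v ≤ t) ∧ (T.dep v ≤ t → (W t v).dist = T.dep v) := by
  unfold View.known View.dist
  simp only [run_lead, h]
  by_cases hv : v = T.root
  · simp [hv, T.dep_root]
  · have hd := T.dep_par v hv
    simp only [hv, false_or, if_false]
    constructor
    · constructor
      · rintro ⟨q, hq, u, hu, rfl⟩
        have := hT.dep_le v u hu
        omega
      · intro hle
        exact ⟨T.dep (T.par v), by omega, T.par v, hT.adj_par v hv, rfl⟩
    · intro hle
      rw [← hd, add_left_inj]
      refine IsLeast.csInf_eq ⟨⟨by omega, T.par v, hT.adj_par v hv, rfl⟩, ?_⟩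
      rintro q ⟨-, u, hu, rfl⟩
      have := hT.dep_le v u hu
      omega

theorem heard_of_outBfs (hid : Function.Injective ident)
    (h : ∀ q < t, ∀ u x, ((W q u).outBfs x).isSome ↔ T.dep u = q) :
    (W t v).heard = {q | q < t ∧ ∃ u, G.Adj v u ∧ T.dep u = q} := by
  ext q
  simp only [View.heard, mem_run_nbrs, Set.mem_ofPred_eq]
  by_cases hq : q < t
  · constructor
    · rintro ⟨y, ⟨u, hu, rfl⟩, h1⟩
      rw [run_hist hid hq hu.symm] at h1
      exact ⟨hq, u, hu, (h q hq u _).mp h1⟩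
    · rintro ⟨-, u, hu, h1⟩
      refine ⟨_, ⟨u, hu, rfl⟩, ?_⟩
      rw [run_hist hid hq hu.symm]
      exact (h q hq u _).mpr h1
  · simp [run_hist_of_le (not_lt.mp hq), hq]

/-- Announcing requires the distance, and the distance comes from announcements. The recursion is
well founded since only earlier rounds are read. -/
theorem outBfs_isSome (hid : Function.Injective ident) (hT : IsBfsTree G ident T) (t : ℕ) :
    ∀ v x, ((W t v).outBfs x).isSome ↔ T.dep v = t := by
  induction t using Nat.strong_induction_on with
  | _ t ih =>
    intro v x
    obtain ⟨h1, h2⟩ := dist_of_heard hT (heard_of_outBfs (v := v) hid ih)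
    unfold View.outBfs
    rw [h1, run_t]
    by_cases h : T.dep v ≤ t
    · rw [h2 h]
      by_cases h3 : t = T.dep v
      · simp [h3]
      · simp [h3, Ne.symm h3]
    · simp [h]; omega

/-! ### Parents, children, subtree sizes and the downward broadcast. -/

section

variable (hid : Function.Injective ident) (hT : IsBfsTree G ident T)

include hid hT

theorem known_iff : (W t v).known ↔ T.dep v ≤ t :=
  (dist_of_heard hT (heard_of_outBfs hid fun q _ => outBfs_isSome hid hT q)).1

theorem dist_eq (h : T.dep v ≤ t) : (W t v).dist = T.dep v :=
  (dist_of_heard hT (heard_of_outBfs hid fun q _ => outBfs_isSome hid hT q)).2 h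

theorem parId_eq (hv : v ≠ T.root) (h : T.dep v ≤ t) : (W t v).parId = ident (T.par v) := by
  have hd := T.dep_par v hv
  unfold View.parId
  rw [dist_eq hid hT h]
  refine IsLeast.csInf_eq ⟨⟨mem_run_nbrs.mpr ⟨_, hT.adj_par v hv, rfl⟩, ?_⟩, ?_⟩
  · rw [run_hist hid (by omega) (hT.adj_par v hv).symm]
    exact (outBfs_isSome hid hT _ _ _).mpr (by omega)
  · rintro y ⟨hy, h1⟩
    obtain ⟨u, hu, rfl⟩ := mem_run_nbrs.mp hy
    rw [run_hist hid (by omega) hu.symm] at h1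
    have := (outBfs_isSome hid hT _ _ _).mp h1
    exact hT.ident_par_le v u hv hu (by omega)

theorem isPar_iff (h : T.dep v ≤ t) : (W t v).isPar (ident u) ↔ T.Child u v := by
  unfold View.isPar ParentTree.Child
  rw [Bool.eq_false_iff, Ne, run_lead]
  refine and_congr_right fun hv => ?_
  rw [parId_eq hid hT hv h, hid.eq_iff, eq_comm]

theorem outBfs_eq (h : T.dep v = t) :
    (W t v).outBfs (ident u) = some (if T.Child u v then 1 else 0) := by
  unfold View.outBfs
  rw [known_iff hid hT, run_t, dist_eq hid hT h.le, if_pos ⟨h.le, h.symm⟩]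
  simp only [isPar_iff hid hT h.le]

theorem mem_kids_iff (h : T.dep v + 2 ≤ t) {x : ℕ} :
    x ∈ (W t v).kids ↔ ∃ c, T.Child v c ∧ ident c = x := by
  unfold View.kids
  rw [Finset.mem_filter, mem_run_nbrs, dist_eq hid hT (by omega)]
  have key : ∀ u, G.Adj v u →
      ((W t v).hist (T.dep v + 1) (ident u) 0 = some 1 ↔ T.Child v u) := by
    intro u hu
    rw [run_hist hid (by omega) hu.symm]
    change (W _ u).outBfs _ = _ ↔ _
    by_cases hd : T.dep u = T.dep v + 1
    · rw [outBfs_eq hid hT hd]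
      by_cases hc : T.Child v u <;> simp [hc]
    · constructor
      · intro h1
        exact absurd ((outBfs_isSome hid hT _ _ _).mp (Option.isSome_of_eq_some h1)) hd
      · intro h1
        exact absurd h1.dep_eq hd
  constructor
  · rintro ⟨⟨u, hu, rfl⟩, h1⟩
    exact ⟨u, (key u hu).mp h1, rfl⟩
  · rintro ⟨u, hu, rfl⟩
    have := hT.adj_of_child hu
    exact ⟨⟨u, this, rfl⟩, (key u this).mpr hu⟩

theorem ident_mem_kids_iff (h : T.dep v + 2 ≤ t) : ident u ∈ (W t v).kids ↔ T.Child v u := by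
  rw [mem_kids_iff hid hT h]
  constructor
  · rintro ⟨c, hc, h1⟩
    rwa [← hid h1]
  · exact fun h1 => ⟨u, h1, rfl⟩

theorem child_of_mem_kids (h : T.dep v ≤ t) (hu : ident u ∈ (W t v).kids) : T.Child v u := by
  by_cases h2 : T.dep v + 2 ≤ t
  · exact (ident_mem_kids_iff hid hT h2).mp hu
  · unfold View.kids at hu
    rw [Finset.mem_filter, dist_eq hid hT h, run_hist_of_le (by omega)] at hu
    simp at hu

theorem sum_kids (h : T.dep v + 2 ≤ t) {M : Type*} [AddCommMonoid M] (f : ℕ → M) :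
    ∑ x ∈ (W t v).kids, f x = ∑ c with T.Child v c, f (ident c) := by
  have : (W t v).kids = (Finset.univ.filter fun c => T.Child v c).image ident := by
    ext x
    rw [mem_kids_iff hid hT h]
    simp
  rw [this, Finset.sum_image hid.injOn]

/-- A vertex u knows its children from round `T.dep u + 2` on, and its effect climbs one level per
round, reaching v after another `T.dep u - T.dep v` rounds. Reports are repeated in every round, so
only the previous round need be read. -/
theorem ready_iff (hq : q ≤ t) :
    (W t v).ready q ↔ ∀ u, T.Sub v u → 2 * T.dep u + 2 ≤ q + T.dep v := by
  induction q using Nat.strong_induction_on generalizing t v with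
  | _ q ih =>
    unfold View.ready
    by_cases hd : T.dep v + 2 ≤ q
    · have h1 : (∀ x ∈ (W t v).kids, ((W t v).hist (q - 1) x 1).isSome) ↔
          ∀ c, T.Child v c → ∀ u, T.Sub c u → 2 * T.dep u + 2 ≤ q - 1 + T.dep c := by
        simp only [mem_kids_iff hid hT (show T.dep v + 2 ≤ t by omega)]
        constructor
        · intro h c hc
          have := h _ ⟨c, hc, rfl⟩
          rw [run_hist hid (by omega) (hT.adj_of_child hc).symm] at this
          change ((W _ c).outEcho _).isSome = true at this
          unfold View.outEcho at this
          split_ifs at this with h2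
          · rw [run_t] at h2
            exact (ih (q - 1) (by omega) le_rfl).mp h2.2
          · simp at this
        · rintro h x ⟨c, hc, rfl⟩
          rw [run_hist hid (by omega) (hT.adj_of_child hc).symm]
          change ((W _ c).outEcho _).isSome = true
          unfold View.outEcho
          rw [run_t, if_pos ⟨(isPar_iff hid hT (by have := hc.dep_eq; omega)).mpr hc,
            (ih (q - 1) (by omega) le_rfl).mpr (h c hc)⟩]
          rfl
      rw [h1, known_iff hid hT, dist_eq hid hT (by omega)]
      constructor
      · rintro ⟨-, -, h2⟩ u hu
        rcases sub_iff_eq_or_child.mp hu with rfl | ⟨c, hc, hu⟩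
        · omega
        · have := h2 c hc u hu
          have := hc.dep_eq
          omega
      · refine fun h2 => ⟨by omega, hd, fun c hc u hu => ?_⟩
        have := h2 u (hc.sub.trans hu)
        have := hc.dep_eq
        omega
    · constructor
      · rintro ⟨h1, h2, -⟩
        rw [known_iff hid hT] at h1
        rw [dist_eq hid hT h1] at h2
        exact absurd h2 hd
      · intro h
        have := h v (Sub.refl v)
        omega

theorem size_eq_of_ready (h : ∀ u, T.Sub v u → 2 * T.dep u + 2 ≤ t + T.dep v) :
    (W t v).size = T.size v ∧ ∀ c, T.Child v c → (W t v).hist (t - 1) (ident c) 1 =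
      some (T.size c) := by
  induction t using Nat.strong_induction_on generalizing v with
  | _ t ih =>
    have h0 := h v (Sub.refl v)
    have h1 : ∀ c, T.Child v c → (W t v).hist (t - 1) (ident c) 1 = some (T.size c) := by
      intro c hc
      have hd := hc.dep_eq
      have h2 : ∀ u, T.Sub c u → 2 * T.dep u + 2 ≤ t - 1 + T.dep c := by
        intro u hu
        have := h u (hc.sub.trans hu)
        omega
      rw [run_hist hid (by omega) (hT.adj_of_child hc).symm]
      change (W _ c).outEcho _ = _
      unfold View.outEcho
      rw [run_t, if_pos ⟨(isPar_iff hid hT (by omega)).mpr hc,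
        (ready_iff hid hT le_rfl).mpr h2⟩, (ih (t - 1) (by omega) h2).1]
    refine ⟨?_, h1⟩
    unfold View.size
    rw [sum_kids hid hT (by omega), T.size_eq v, run_t]
    congr 1
    refine Finset.sum_congr rfl fun c hc => ?_
    rw [h1 c (Finset.mem_filter.mp hc).2]
    rfl

theorem ready_root_iff (hq : q ≤ t) : (W t T.root).ready q ↔ 2 * T.height + 2 ≤ q := by
  rw [ready_iff hid hT hq, T.dep_root]
  constructor
  · intro h
    have hpos : 2 ≤ q := by have := h T.root (Sub.refl _); omega
    have : T.height ≤ (q - 2) / 2 := Finset.sup_le fun u _ => by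
      have := h u (sub_root u); omega
    omega
  · intro h u _
    have := T.dep_le_height u
    omega

theorem size_root_eq (h : 2 * T.height + 2 ≤ t) : (W t T.root).size = Fintype.card V := by
  rw [← T.size_root]
  refine (size_eq_of_ready hid hT fun u _ => ?_).1
  have := T.dep_le_height u
  omega

theorem hist_size (h : 2 * T.height + 2 ≤ t) (hc : T.Child v c) :
    (W t v).hist (t - 1) (ident c) 1 = some (T.size c) := by
  refine (size_eq_of_ready hid hT fun u _ => ?_).2 c hc
  have := T.dep_le_height u
  omega

theorem hist_par (hv : v ≠ T.root) (h : T.dep v ≤ t) (hq : q < t) :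
    (W t v).hist q (W t v).parId = (W q (T.par v)).out (ident v) := by
  rw [parId_eq hid hT hv h, run_hist hid hq (hT.adj_par v hv).symm]

theorem numV_eq_some (h : 2 * T.height + 2 + T.dep v ≤ t) :
    (W t v).numV = some (Fintype.card V) := by
  induction t generalizing v with
  | zero => omega
  | succ t ih =>
    unfold View.numV
    by_cases hv : v = T.root
    · subst hv
      rw [T.dep_root] at h
      rw [if_pos (run_lead.mpr rfl), run_t, if_pos ((ready_root_iff hid hT le_rfl).mpr h),
        size_root_eq hid hT h]
    · have hd := T.dep_par v hv
      rw [if_neg (by rwa [run_lead]), if_pos ((known_iff hid hT).mpr (by omega)), run_t,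
        Nat.add_sub_cancel, hist_par hid hT hv (by omega) (by omega)]
      change (W _ _).outN _ = _
      unfold View.outN
      rw [if_pos ((ident_mem_kids_iff hid hT (by omega)).mpr ⟨hv, rfl⟩), ih (by omega)]

/-- The exact time of arrival matters: `active` then certifies that the size, height and preorder
number held by the vertex are correct, and nothing guarded by it is sent too early. -/
theorem numV_eq_none (h : ¬ 2 * T.height + 2 + T.dep v ≤ t) : (W t v).numV = none := by
  induction t generalizing v with
  | zero =>
    unfold View.numV
    split_ifs with h1 h2 h3
    · rw [run_t] at h2
      rw [run_lead] at h1
      subst h1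
      rw [ready_root_iff hid hT le_rfl] at h2
      omega
    · rfl
    · rw [run_hist_of_le (Nat.zero_le _)]
    · rfl
  | succ t ih =>
    unfold View.numV
    by_cases hv : v = T.root
    · subst hv
      rw [T.dep_root] at h
      rw [if_pos (run_lead.mpr rfl), run_t,
        if_neg (fun h' => h ((ready_root_iff hid hT le_rfl).mp h'))]
    · have hd := T.dep_par v hv
      rw [if_neg (by rwa [run_lead])]
      by_cases hk : T.dep v ≤ t + 1
      · rw [if_pos ((known_iff hid hT).mpr hk), run_t, Nat.add_sub_cancel,
          hist_par hid hT hv hk (by omega)]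
        change (W _ _).outN _ = _
        unfold View.outN
        rw [ih (by omega), ite_self]
      · rw [if_neg (fun h' => hk ((known_iff hid hT).mp h'))]

theorem active_iff : (W t v).active ↔ 2 * T.height + 2 + T.dep v ≤ t := by
  unfold View.active
  by_cases h : 2 * T.height + 2 + T.dep v ≤ t
  · simp [numV_eq_some hid hT h, h]
  · simp [numV_eq_none hid hT h, h]

theorem height_eq (h : 2 * T.height + 2 + T.dep v ≤ t) : (W t v).height = some T.height := by
  induction t generalizing v with
  | zero => omega
  | succ t ih =>
    unfold View.height
    by_cases hv : v = T.root
    · subst hv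
      rw [T.dep_root] at h
      rw [if_pos (run_lead.mpr rfl), run_t, if_pos ((ready_root_iff hid hT le_rfl).mpr h)]
      have : sInf {q | (W (t + 1) T.root).ready q} = 2 * T.height + 2 := by
        refine IsLeast.csInf_eq ⟨(ready_root_iff hid hT h).mpr le_rfl, fun q hq => ?_⟩
        by_contra hlt
        exact hlt ((ready_root_iff hid hT (by omega)).mp hq)
      rw [this]
      congr 1
      omega
    · have hd := T.dep_par v hv
      rw [if_neg (by rwa [run_lead]), if_pos ((known_iff hid hT).mpr (by omega)), run_t,
        Nat.add_sub_cancel, hist_par hid hT hv (by omega) (by omega)]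
      change (W _ _).outH _ = _
      unfold View.outH
      rw [ih (by omega), if_pos]
      exact ⟨(ident_mem_kids_iff hid hT (by omega)).mpr ⟨hv, rfl⟩,
        (active_iff hid hT).mpr (by omega)⟩

theorem outPre_eq (h : 2 * T.height + 2 + T.dep v ≤ t)
    (hn : (W t v).number = some (T.pre ident v)) (hc : T.Child v c) :
    (W t v).outPre (ident c) = some (T.pre ident c) := by
  unfold View.outPre
  rw [if_pos ⟨(ident_mem_kids_iff hid hT (by omega)).mpr hc, (active_iff hid hT).mpr h⟩, hn,
    pre_child hc, Finset.sum_filter, sum_kids hid hT (by omega), run_t, ← Finset.filter_filter,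
    Finset.sum_filter (p := fun c' => ident c' < ident c)]
  congr 2
  refine Finset.sum_congr rfl fun c' hc' => ?_
  rw [hist_size hid hT (by omega) (Finset.mem_filter.mp hc').2]
  rfl

theorem number_eq (h : 2 * T.height + 2 + T.dep v ≤ t) :
    (W t v).number = some (T.pre ident v) := by
  induction t generalizing v with
  | zero => omega
  | succ t ih =>
    unfold View.number
    by_cases hv : v = T.root
    · subst hv
      rw [if_pos (run_lead.mpr rfl), pre_root]
    · have hd := T.dep_par v hv
      rw [if_neg (by rwa [run_lead]), if_pos ((known_iff hid hT).mpr (by omega)), run_t,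
        Nat.add_sub_cancel, hist_par hid hT hv (by omega) (by omega)]
      exact outPre_eq hid hT (by omega) (ih (by omega)) ⟨hv, rfl⟩

end

end Closed

/-! ### The execution: random vectors and lists of ancestors -/

section Closed

open Classical

variable {V : Type*} [Fintype V] {G : SimpleGraph V} {ident : V → ℕ} {T : ParentTree V}
  {ω : DistAlg.Coins V} {t q i k : ℕ} {v u c : V}

local notation "W" => run G ident T.root ω

/-- The length of the random vectors in a network with the vertex set `V`. -/
noncomputable def vecLength (V : Type*) [Fintype V] : ℕ := 5 * Nat.clog 2 (Fintype.card V)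

/-- The random vector of `v` for its neighbour `u`. -/
noncomputable def randVec (T : ParentTree V) (ident : V → ℕ) (ω : DistAlg.Coins V) (v u : V) :
    ℕ → ZMod 2 :=
  coinVec ω (3 * T.height + 2) (vecLength V) v (ident u)

local notation "RV" => randVec T ident ω

theorem randVec_mem (v u : V) : RV v u ∈ vecs (vecLength V) := coinVec_mem _ _ _ _ _

section

variable (hid : Function.Injective ident) (hT : IsBfsTree G ident T)

include hid hT

theorem ht_eq (h : 2 * T.height + 2 + T.dep v ≤ t) : (W t v).ht = T.height := by
  rw [View.ht, height_eq hid hT h]; rfl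

theorem bits_eq (h : 2 * T.height + 2 + T.dep v ≤ t) : (W t v).bits = vecLength V := by
  rw [View.bits, numV_eq_some hid hT h]; rfl

theorem base_eq (h : 2 * T.height + 2 + T.dep v ≤ t) : (W t v).base = 3 * T.height + 2 := by
  rw [View.base, ht_eq hid hT h]

theorem listRound_eq (h : 2 * T.height + 2 + T.dep v ≤ t) :
    (W t v).listRound = 4 * T.height + 4 := by
  rw [View.listRound, base_eq hid hT h, ht_eq hid hT h]; omega

theorem flagRound_eq (h : 2 * T.height + 2 + T.dep v ≤ t) :
    (W t v).flagRound = 5 * T.height + 4 := by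
  rw [View.flagRound, listRound_eq hid hT h, ht_eq hid hT h]; omega

theorem finalRound_eq (h : 2 * T.height + 2 + T.dep v ≤ t) :
    (W t v).finalRound = 6 * T.height + 4 := by
  rw [View.finalRound, flagRound_eq hid hT h, ht_eq hid hT h]; omega

omit hid hT in
theorem informed_of_le (h : 3 * T.height + 2 ≤ t) : 2 * T.height + 2 + T.dep v ≤ t := by
  have := T.dep_le_height v
  omega

theorem rnd_eq (ht : 3 * T.height + 2 < t) (hu : G.Adj v u) :
    (W t v).rnd (ident u) = RV v u := by
  have h1 := informed_of_le (v := v) ht.le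
  have h2 := informed_of_le (v := v) (le_refl (3 * T.height + 2))
  unfold View.rnd randVec coinVec
  rw [bits_eq hid hT h1, base_eq hid hT h1, run_coin ht]
  have hc : (W (3 * T.height + 2) v).coins =
      vecLength V * ((W (3 * T.height + 2) v).nbrs.sup id + 1) := by
    unfold View.coins
    rw [if_pos ⟨(active_iff hid hT).mpr h2, by rw [run_t, base_eq hid hT h2]⟩, bits_eq hid hT h2]
  have hx : ident u ≤ (W (3 * T.height + 2) v).nbrs.sup id :=
    Finset.le_sup (f := id) (mem_run_nbrs.mpr ⟨u, hu, rfl⟩)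
  funext j
  by_cases hj : j < vecLength V
  -- Enough coins are flipped for one block per number up to the largest neighbouring ID, so no
  -- default value of `getD` is read.
  · have hlt : ident u * vecLength V + j < (W (3 * T.height + 2) v).coins := by
      rw [hc]
      have := Nat.mul_le_mul_left (vecLength V) (Nat.add_le_add_right hx 1)
      rw [mul_add, mul_one, mul_comm] at this
      omega
    rw [List.getD_eq_getElem _ _ (by simpa using hlt), List.getElem_ofFn]
  · simp [hj]

theorem nonVal_eq (ht : 3 * T.height + 3 < t) (hu : G.Adj v u) :
    (W t v).nonVal (ident u) = RV v u + RV u v := by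
  have h1 := informed_of_le (v := v) (show 3 * T.height + 2 ≤ t by omega)
  have h2 := informed_of_le (v := u) (show 3 * T.height + 2 ≤ 3 * T.height + 3 by omega)
  unfold View.nonVal
  rw [rnd_eq hid hT (by omega) hu, base_eq hid hT h1, run_hist hid ht hu.symm]
  change _ + valOf (((W _ u).outExVal _).getD 0) = _
  unfold View.outExVal
  rw [if_pos ⟨(active_iff hid hT).mpr h2, by rw [run_t, base_eq hid hT h2]⟩, bits_eq hid hT h2,
    rnd_eq hid hT (by omega) hu.symm, Option.getD_some, valOf_natOf (randVec_mem _ _)]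

theorem nonPre_eq (ht : 3 * T.height + 3 < t) (hu : G.Adj v u) :
    (W t v).nonPre (ident u) = T.pre ident u := by
  have h1 := informed_of_le (v := v) (show 3 * T.height + 2 ≤ t by omega)
  have h2 := informed_of_le (v := u) (show 3 * T.height + 2 ≤ 3 * T.height + 3 by omega)
  unfold View.nonPre
  rw [base_eq hid hT h1, run_hist hid ht hu.symm]
  change ((W _ u).outExPre (ident v)).getD 0 = _
  unfold View.outExPre
  rw [if_pos ⟨(active_iff hid hT).mpr h2, by rw [run_t, base_eq hid hT h2]⟩,
    number_eq hid hT h2]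
  rfl

theorem isNon_iff (ht : T.dep v + 2 ≤ t) {x : ℕ} :
    (W t v).isNon x ↔ ∃ u, NonTree G T v u ∧ ident u = x := by
  unfold View.isNon
  rw [mem_run_nbrs]
  constructor
  · rintro ⟨⟨u, hu, rfl⟩, h1, h2⟩
    rw [isPar_iff hid hT (by omega)] at h1
    rw [ident_mem_kids_iff hid hT ht] at h2
    exact ⟨u, ⟨hu, h1, h2⟩, rfl⟩
  · rintro ⟨u, ⟨hu, h1, h2⟩, rfl⟩
    rw [isPar_iff hid hT (by omega), ident_mem_kids_iff hid hT ht]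
    exact ⟨⟨u, hu, rfl⟩, h1, h2⟩

theorem isNon_ident_iff (ht : T.dep v + 2 ≤ t) :
    (W t v).isNon (ident u) ↔ NonTree G T v u := by
  rw [isNon_iff hid hT ht]
  constructor
  · rintro ⟨c, hc, h1⟩
    rwa [← hid h1]
  · exact fun h1 => ⟨u, h1, rfl⟩

/-- Depth h is correct from round 3h + 4, just after the exchange, and each level upwards needs one
more round. Values sent earlier may be wrong, but they are overwritten since they are sent anew in
every round. -/
theorem phi_eq (ht : 4 * T.height + 4 ≤ t + T.dep v) : (W t v).phi = up G T RV v := by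
  induction hm : T.height - T.dep v using Nat.strong_induction_on generalizing v t with
  | _ m ih =>
    have hdv := T.dep_le_height v
    have h1 := informed_of_le (v := v) (show 3 * T.height + 2 ≤ t by omega)
    unfold View.phi
    rw [up_eq, sum_kids hid hT (by omega)]
    congr 1
    · have : ((W t v).nbrs.filter fun x => (W t v).isNon x) =
          (Finset.univ.filter fun u => NonTree G T v u).image ident := by
        ext x
        simp only [Finset.mem_filter, Finset.mem_image, Finset.mem_univ, true_and]
        rw [isNon_iff hid hT (by omega), mem_run_nbrs]
        constructor
        · exact fun h => h.2
        · rintro ⟨u, hu, rfl⟩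
          exact ⟨⟨u, hu.1, rfl⟩, u, hu, rfl⟩
      rw [this, Finset.sum_image hid.injOn]
      refine Finset.sum_congr rfl fun u hu => ?_
      exact nonVal_eq hid hT (by omega) (Finset.mem_filter.mp hu).2.1
    · refine Finset.sum_congr rfl fun c hc => ?_
      have hc := (Finset.mem_filter.mp hc).2
      have hd := hc.dep_eq
      have hdc := T.dep_le_height c
      have h2 := informed_of_le (v := c) (show 3 * T.height + 2 ≤ t - 1 by omega)
      rw [run_t, run_hist hid (by omega) (hT.adj_of_child hc).symm]
      change valOf (((W _ c).outUp _).getD 0) = _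
      unfold View.outUp
      rw [if_pos ⟨(active_iff hid hT).mpr h2, (isPar_iff hid hT (by omega)).mpr hc,
        by rw [run_t, base_eq hid hT h2]; omega⟩, bits_eq hid hT h2, Option.getD_some]
      rw [ih _ (by omega) (by omega) rfl, valOf_natOf (up_mem_vecs randVec_mem _)]

/-- `v` sends its list of ancestors to `u` over a non-tree edge. -/
def Selected (G : SimpleGraph V) (T : ParentTree V) (ident : V → ℕ) (v u : V) : Prop :=
  NonTree G T v u ∧ ((∀ w, NonTree G T v w → T.pre ident u ≤ T.pre ident w) ∨
    ∀ w, NonTree G T v w → T.pre ident w ≤ T.pre ident u)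

theorem selected_iff (ht : 3 * T.height + 3 < t) :
    (W t v).selected (ident u) ↔ Selected G T ident v u := by
  have hdv := T.dep_le_height v
  unfold View.selected Selected
  rw [isNon_ident_iff hid hT (by omega)]
  refine and_congr_right fun hu => ?_
  rw [nonPre_eq hid hT ht hu.1]
  have key : ∀ p : ℕ → Prop, (∀ y, (W t v).isNon y → p ((W t v).nonPre y)) ↔
      ∀ w, NonTree G T v w → p (T.pre ident w) := by
    intro p
    constructor
    · intro h w hw
      rw [← nonPre_eq hid hT ht hw.1]
      exact h _ ((isNon_ident_iff hid hT (by omega)).mpr hw)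
    · intro h y hy
      obtain ⟨w, hw, rfl⟩ := (isNon_iff hid hT (by omega)).mp hy
      rw [nonPre_eq hid hT ht hw.1]
      exact h w hw
  rw [key (fun n => T.pre ident u ≤ n), key (fun n => n ≤ T.pre ident u)]

/-- Pipelining: the i-th entry of the parent, forwarded in round 4h + 4 + i, is the (i+1)-st entry
of the child. Lists stop before the root, which has no edge above it. -/
theorem anc_eq (ht : 4 * T.height + 4 + i ≤ t) :
    (W t v).ancPre i = (if i < T.dep v then some (T.pre ident (T.par^[i] v)) else none) ∧
    (W t v).ancVal i =
      (if i < T.dep v then some (natOf (vecLength V) (up G T RV (T.par^[i] v))) else none) := by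
  induction i generalizing v t with
  | zero =>
    have h1 := informed_of_le (v := v) (show 3 * T.height + 2 ≤ t by omega)
    unfold View.ancPre View.ancVal
    by_cases hv : v = T.root
    · subst hv
      rw [if_pos (run_lead.mpr rfl), if_pos (run_lead.mpr rfl), T.dep_root]
      simp
    · have hl : ¬ (W t v).lead = true := by rwa [run_lead]
      rw [if_neg hl, if_neg hl, if_pos rfl, if_pos rfl,
        if_pos (dep_pos hv), if_pos (dep_pos hv), number_eq hid hT h1, bits_eq hid hT h1,
        phi_eq hid hT (by omega)]
      exact ⟨rfl, rfl⟩
  | succ i ih =>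
    have h1 := informed_of_le (v := v) (show 3 * T.height + 2 ≤ t by omega)
    have hdv := T.dep_le_height v
    unfold View.ancPre View.ancVal
    by_cases hv : v = T.root
    · subst hv
      rw [if_pos (run_lead.mpr rfl), if_pos (run_lead.mpr rfl), T.dep_root]
      simp
    · have hd := T.dep_par v hv
      have h2 := informed_of_le (v := T.par v)
        (show 3 * T.height + 2 ≤ 4 * T.height + 4 + i by omega)
      have hl : ¬ (W t v).lead = true := by rwa [run_lead]
      rw [if_neg hl, if_neg hl, if_neg (Nat.succ_ne_zero i), if_neg (Nat.succ_ne_zero i), listRound_eq hid hT h1, ← add_assoc, Nat.add_sub_cancel,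
        hist_par hid hT hv (by omega) (by omega)]
      change (W _ _).outLstPre _ = _ ∧ (W _ _).outLstVal _ = _
      unfold View.outLstPre View.outLstVal
      have hcond : (W (4 * T.height + 4 + i) (T.par v)).active ∧
          (W (4 * T.height + 4 + i) (T.par v)).listRound ≤
            (W (4 * T.height + 4 + i) (T.par v)).t ∧
          (ident v ∈ (W (4 * T.height + 4 + i) (T.par v)).kids ∨
            (W (4 * T.height + 4 + i) (T.par v)).selected (ident v)) :=
        ⟨(active_iff hid hT).mpr h2, by rw [run_t, listRound_eq hid hT h2]; omega,
          Or.inl ((ident_mem_kids_iff hid hT (by omega)).mpr ⟨hv, rfl⟩)⟩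
      rw [if_pos hcond, if_pos hcond, run_t, listRound_eq hid hT h2, Nat.add_sub_cancel_left,
        (ih le_rfl).1, (ih le_rfl).2, Function.iterate_succ_apply]
      have h3 : i < T.dep (T.par v) ↔ i + 1 < T.dep v := by omega
      simp only [h3, and_self]

theorem hist_lst (ht : 5 * T.height + 4 ≤ t) {j : ℕ} (hu : NonTree G T v u) :
    ((W t v).hist (4 * T.height + 4 + j) (ident u) 8 =
      if Selected G T ident u v ∧ j < T.dep u then some (T.pre ident (T.par^[j] u)) else none) ∧
    ((W t v).hist (4 * T.height + 4 + j) (ident u) 9 =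
      if Selected G T ident u v ∧ j < T.dep u then
        some (natOf (vecLength V) (up G T RV (T.par^[j] u))) else none) := by
  have hdu := T.dep_le_height u
  by_cases hj : 4 * T.height + 4 + j < t
  · have h2 := informed_of_le (v := u) (show 3 * T.height + 2 ≤ 4 * T.height + 4 + j by omega)
    rw [run_hist hid hj hu.1.symm]
    change (W _ _).outLstPre _ = _ ∧ (W _ _).outLstVal _ = _
    unfold View.outLstPre View.outLstVal
    rw [run_t, listRound_eq hid hT h2, Nat.add_sub_cancel_left, (anc_eq hid hT le_rfl).1,
      (anc_eq hid hT le_rfl).2]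
    simp only [selected_iff hid hT (show 3 * T.height + 3 < 4 * T.height + 4 + j by omega),
      ident_mem_kids_iff hid hT (show T.dep u + 2 ≤ 4 * T.height + 4 + j by omega),
      active_iff hid hT, h2, hu.2.1, Nat.le_add_right, true_and, false_or]
    by_cases hs : Selected G T ident u v <;> simp [hs]
  -- An entry that has not arrived by round 5h + 4 has index at least h and therefore does not
  -- exist.
  · rw [run_hist_of_le (not_lt.mp hj), if_neg (by omega), if_neg (by omega)]
    exact ⟨rfl, rfl⟩

end

/-- The vertex `v` detects that the tree edge above its `i`-th ancestor lies in a cut pair. -/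
def Detects (G : SimpleGraph V) (T : ParentTree V) (ident : V → ℕ) (R : V → V → ℕ → ZMod 2)
    (v : V) (i : ℕ) : Prop :=
  i < T.dep v ∧ up G T R (T.par^[i] v) ≠ 0 ∧
    ((∃ j, j ≠ i ∧ j < T.dep v ∧ up G T R (T.par^[j] v) = up G T R (T.par^[i] v)) ∨
      (∃ u, NonTree G T v u ∧ circ G T R v u = up G T R (T.par^[i] v)) ∨
      ∃ u j, NonTree G T v u ∧ Selected G T ident u v ∧ j < T.dep u ∧
        up G T R (T.par^[j] u) = up G T R (T.par^[i] v) ∧ T.par^[j] u ≠ T.par^[i] v)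

theorem natOf_eq_zero {b : ℕ} {f : ℕ → ZMod 2} (hf : f ∈ vecs b) : natOf b f = 0 ↔ f = 0 := by
  have h0 : natOf b 0 = 0 := by
    have h1 : valOf 0 = 0 := by funext j; simp [valOf]
    have h2 := natOf_lt b 0
    apply Nat.eq_of_testBit_eq
    intro j
    rw [Nat.zero_testBit]
    by_contra h3
    have h4 := congrFun (valOf_natOf (zero_mem (vecs b))) j
    simp [valOf, h3] at h4
  rw [← h0, natOf_inj hf (zero_mem _)]

section

variable (hid : Function.Injective ident) (hT : IsBfsTree G ident T)

include hid hT

theorem nonVal_eq_circ (ht : 3 * T.height + 3 < t) (hu : NonTree G T v u) :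
    (W t v).nonVal (ident u) = circ G T RV v u := by
  rw [nonVal_eq hid hT ht hu.1, circ_of_nonTree hu]

theorem detects_iff (ht : 5 * T.height + 4 ≤ t) (hi : i < T.dep v) :
    (W t v).detects i ↔ Detects G T ident RV v i := by
  have hdv := T.dep_le_height v
  have h1 := informed_of_le (v := v) (show 3 * T.height + 2 ≤ t by omega)
  have hu : ∀ x, up G T RV x ∈ vecs (vecLength V) := up_mem_vecs randVec_mem
  have hval : ∀ j w, (W t v).ancVal j = some w ↔
      j < T.dep v ∧ natOf (vecLength V) (up G T RV (T.par^[j] v)) = w := by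
    intro j w
    by_cases hj : 4 * T.height + 4 + j ≤ t
    · rw [(anc_eq hid hT hj).2]
      split_ifs with h <;> simp [h]
    · have hne : j ≠ 0 := by omega
      unfold View.ancVal
      rw [if_neg hne, listRound_eq hid hT h1, run_hist_of_le (by omega)]
      simp
      omega
  have hpre := (anc_eq (v := v) (ω := ω) hid hT (show 4 * T.height + 4 + i ≤ t by omega)).1
  rw [if_pos hi] at hpre
  unfold View.detects Detects
  rw [hpre, listRound_eq hid hT h1, bits_eq hid hT h1]
  simp only [hval, isNon_iff hid hT (show T.dep v + 2 ≤ t by omega)]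
  constructor
  · rintro ⟨w, hw0, ⟨-, rfl⟩, h2⟩
    refine ⟨hi, fun h => hw0 ((natOf_eq_zero (hu _)).mpr h), ?_⟩
    rcases h2 with ⟨j, hj, hjd, h3⟩ | ⟨x, ⟨u, hu', rfl⟩, h3⟩ | ⟨x, j, ⟨u, hu', rfl⟩, h3, h4⟩
    · exact Or.inl ⟨j, hj, hjd, (natOf_inj (hu _) (hu _)).mp h3⟩
    · rw [nonVal_eq_circ hid hT (by omega) hu',
        natOf_inj (circ_mem_vecs randVec_mem _ _) (hu _)] at h3
      exact Or.inr (Or.inl ⟨u, hu', h3⟩)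
    · rw [(hist_lst hid hT ht hu').2] at h3
      rw [(hist_lst hid hT ht hu').1] at h4
      split_ifs at h3 with h5
      rw [if_pos h5] at h4
      rw [Option.some_inj, natOf_inj (hu _) (hu _)] at h3
      exact Or.inr (Or.inr ⟨u, j, hu', h5.1, h5.2, h3, fun h6 => h4 (by rw [h6])⟩)
  · rintro ⟨-, h0, h2⟩
    refine ⟨_, fun h => h0 ((natOf_eq_zero (hu _)).mp h), ⟨hi, rfl⟩, ?_⟩
    rcases h2 with ⟨j, hj, hjd, h3⟩ | ⟨u, hu', h3⟩ | ⟨u, j, hu', hs, hj, h3, h4⟩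
    · exact Or.inl ⟨j, hj, hjd, by rw [h3]⟩
    · exact Or.inr (Or.inl ⟨_, ⟨u, hu', rfl⟩, by rw [nonVal_eq_circ hid hT (by omega) hu', h3]⟩)
    · refine Or.inr (Or.inr ⟨_, j, ⟨u, hu', rfl⟩, ?_, ?_⟩)
      · rw [(hist_lst hid hT ht hu').2, if_pos ⟨hs, hj⟩, h3]
      · rw [(hist_lst hid hT ht hu').1, if_pos ⟨hs, hj⟩]
        exact fun h5 => h4 (pre_injective hid (Option.some_inj.mp h5))

/-- Reports on the ancestor at depth k leave level d in round 5h + 4 + (h - d) + k, so each level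
passes on one depth per round. The bounds on k keep the truncated subtractions exact. -/
theorem flag_iff (hk : 0 < k) (hkv : k ≤ T.dep v) (ht : 6 * T.height + 4 + k ≤ t + T.dep v) :
    (W t v).flag k ↔ ∃ u, T.Sub v u ∧ Detects G T ident RV u (T.dep u - k) := by
  induction hm : T.height - T.dep v using Nat.strong_induction_on generalizing v t with
  | _ m ih =>
    have hdv := T.dep_le_height v
    have h1 := informed_of_le (v := v) (show 3 * T.height + 2 ≤ t by omega)
    have hkids : (∃ x ∈ (W t v).kids, ((W t v).hist ((W t v).flagRound +
        ((W t v).ht - (W t v).dist) + k - 1) x 10).isSome) ↔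
        ∃ c, T.Child v c ∧ ∃ u, T.Sub c u ∧ Detects G T ident RV u (T.dep u - k) := by
      simp only [mem_kids_iff hid hT (show T.dep v + 2 ≤ t by omega)]
      rw [flagRound_eq hid hT h1, ht_eq hid hT h1, dist_eq hid hT (by omega)]
      have key : ∀ c, T.Child v c → (((W t v).hist (5 * T.height + 4 +
          (T.height - T.dep v) + k - 1) (ident c) 10).isSome ↔
          ∃ u, T.Sub c u ∧ Detects G T ident RV u (T.dep u - k)) := by
        intro c hc
        have hd := hc.dep_eq
        have hdc := T.dep_le_height c
        have h2 := informed_of_le (v := c) (show 3 * T.height + 2 ≤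
          5 * T.height + 4 + (T.height - T.dep v) + k - 1 by omega)
        rw [run_hist hid (by omega) (hT.adj_of_child hc).symm]
        change ((W _ c).outFlag _).isSome = true ↔ _
        unfold View.outFlag
        rw [active_iff hid hT, isPar_iff hid hT (by omega), run_t, flagRound_eq hid hT h2,
          ht_eq hid hT h2, dist_eq hid hT (by omega),
          show 5 * T.height + 4 + (T.height - T.dep v) + k - 1 -
            (5 * T.height + 4 + (T.height - T.dep c)) = k by omega]
        simp only [h2, hc, true_and]
        have h4 := ih (T.height - T.dep c) (by omega) (v := c)
          (t := 5 * T.height + 4 + (T.height - T.dep v) + k - 1) (by omega) (by omega) rfl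
        rw [← h4]
        split_ifs with h <;> simp [h]
      constructor
      · rintro ⟨x, ⟨c, hc, rfl⟩, h3⟩
        exact ⟨c, hc, (key c hc).mp h3⟩
      · rintro ⟨c, hc, h3⟩
        exact ⟨_, ⟨c, hc, rfl⟩, (key c hc).mpr h3⟩
    unfold View.flag
    rw [hkids, dist_eq hid hT (by omega), detects_iff hid hT (by omega) (by omega)]
    constructor
    · rintro (h | ⟨c, hc, u, hu, h⟩)
      · exact ⟨v, Sub.refl v, h⟩
      · exact ⟨u, hc.sub.trans hu, h⟩
    · rintro ⟨u, hu, h⟩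
      rcases sub_iff_eq_or_child.mp hu with rfl | ⟨c, hc, hu⟩
      · exact Or.inl h
      · exact Or.inr ⟨c, hc, u, hu, h⟩

end

end Closed

/-! ### The labels -/

section Closed

open Classical

variable {V : Type*} [Fintype V] {G : SimpleGraph V} {ident : V → ℕ} {T : ParentTree V}
  {ω : DistAlg.Coins V} {t : ℕ} {v u : V} {R : V → V → ℕ → ZMod 2}

local notation "W" => run G ident T.root ω

local notation "RV" => randVec T ident ω

omit [Fintype V] in
theorem ParentTree.iterate_ne_root {j : ℕ} (h : j < T.dep v) : T.par^[j] v ≠ T.root := fun h' => by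
  have := dep_iterate (T := T) j v
  rw [h', T.dep_root] at this
  omega

/-- Soundness: each detection rule exhibits a different edge with the same nonzero value. Such an
edge is a second tree edge on the path, a non-tree edge, or a tree edge above another vertex. -/
theorem exists_isCutPair_of_detects (hG : G.Connected) (hT : IsBfsTree G ident T)
    (hR : Generic G T R) {x : V} {i : ℕ} (h : Detects G T ident R x i) :
    ∃ f, G.IsCutPair s(T.par^[i] x, T.par (T.par^[i] x)) f := by
  obtain ⟨hi, h0, h⟩ := h
  have hv := iterate_ne_root hi
  have he := hT.adj_par _ hv
  rcases h with ⟨j, hj, hjx, h⟩ | ⟨u, hu, h⟩ | ⟨u, j, hu, -, hj, h, hne⟩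
  · have hw := iterate_ne_root hjx
    refine ⟨s(T.par^[j] x, T.par (T.par^[j] x)), (hR.isCutPair_iff hG hT).mpr
      ⟨fun h' => hj ?_, he, hT.adj_par _ hw, ?_, ?_⟩⟩
    · have h1 := congrArg T.dep (treeEdge_injective hv hw h')
      rw [dep_iterate, dep_iterate] at h1
      omega
    · rw [circE_mk, circE_mk, circ_par hv, circ_par hw, h]
    · rwa [circE_mk, circ_par hv]
  · refine ⟨s(x, u), (hR.isCutPair_iff hG hT).mpr ⟨(hu.ne_treeEdge hv).symm, he, hu.1, ?_, ?_⟩⟩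
    · rw [circE_mk, circE_mk, circ_par hv, h]
    · rwa [circE_mk, circ_par hv]
  · have hw := iterate_ne_root hj
    refine ⟨s(T.par^[j] u, T.par (T.par^[j] u)), (hR.isCutPair_iff hG hT).mpr
      ⟨fun h' => hne (treeEdge_injective hv hw h').symm, he, hT.adj_par _ hw, ?_, ?_⟩⟩
    · rw [circE_mk, circE_mk, circ_par hv, circ_par hw, h]
    · rwa [circE_mk, circ_par hv]

omit [Fintype V] in
theorem ParentTree.Sub.dep_sub_lt {x : V} (h : T.Sub v x) (hv : v ≠ T.root) :
    T.dep x - T.dep v < T.dep x := by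
  have := h.dep_le
  have := dep_pos hv
  omega

/-- If some non-tree edge from `a` ends outside the subtree of `w`, then so does one over which a
list of ancestors is sent. -/
theorem exists_selected_of_leaving (hid : Function.Injective ident) {w a c : V}
    (hac : NonTree G T a c) (hc : ¬ T.Sub w c) :
    ∃ c', Selected G T ident a c' ∧ ¬ T.Sub w c' := by
  have hne : (Finset.univ.filter fun c => NonTree G T a c).Nonempty := ⟨c, by simpa using hac⟩
  obtain ⟨m, hm, hmin⟩ := Finset.exists_min_image _ (T.pre ident) hne
  obtain ⟨M, hM, hmax⟩ := Finset.exists_max_image _ (T.pre ident) hne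
  simp only [Finset.mem_filter, Finset.mem_univ, true_and] at hm hmin hM hmax
  by_contra! hall
  -- If both extreme neighbours lay in the interval of w, so would c, which lies between them.
  have h1 := (sub_iff_pre hid).mp (hall m ⟨hm, Or.inl hmin⟩)
  have h2 := (sub_iff_pre hid).mp (hall M ⟨hM, Or.inr hmax⟩)
  have h3 := hmin c hac
  have h4 := hmax c hac
  exact hc ((sub_iff_pre hid).mpr ⟨by omega, by omega⟩)

/-- Completeness, by the position of the partner edge. It is essential that a detecting vertex lies
below v, since reports only travel upwards. -/
theorem exists_detects_of_isCutPair (hid : Function.Injective ident)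
    (hG : G.Connected) (hT : IsBfsTree G ident T) (hR : Generic G T R) (hv : v ≠ T.root)
    {f : Sym2 V} (h : G.IsCutPair s(v, T.par v) f) :
    ∃ x, T.Sub v x ∧ Detects G T ident R x (T.dep x - T.dep v) := by
  obtain ⟨hne, he, hf, heq, h0⟩ := (hR.isCutPair_iff hG hT).mp h
  rw [circE_mk, circ_par hv] at heq h0
  have hsymm : G.IsCutPair f s(v, T.par v) := ⟨h.1.symm, Set.pair_comm _ _ ▸ h.2.1, h.2.2.symm⟩
  rcases mem_edgeSet_cases (T := T) hf with ⟨w, hw, rfl⟩ | ⟨a, c, hac, rfl⟩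
  · rw [circE_mk, circ_par hw] at heq
    have hvw : v ≠ w := fun h' => hne (by rw [h'])
    have hij : ∀ x, T.Sub v x → T.Sub w x → T.dep x - T.dep w ≠ T.dep x - T.dep v := by
      intro x h1 h2 h3
      have := h1.dep_le
      have := h2.dep_le
      exact hvw (h1.eq_of_dep_eq h2 (by omega))
    have hboth : ∀ x, T.Sub v x → T.Sub w x → Detects G T ident R x (T.dep x - T.dep v) := by
      intro x h1 h2
      refine ⟨h1.dep_sub_lt hv, by rwa [h1.iterate_eq], Or.inl
        ⟨T.dep x - T.dep w, hij x h1 h2, h2.dep_sub_lt hw, ?_⟩⟩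
      rw [h1.iterate_eq, h2.iterate_eq, heq]
    by_cases h1 : T.Sub v w
    · exact ⟨w, h1, hboth w h1 (Sub.refl w)⟩
    · by_cases h2 : T.Sub w v
      · exact ⟨v, Sub.refl v, hboth v (Sub.refl v) h2⟩
      -- The selected neighbour c' of a also lies outside the subtree of w, hence below v, and it
      -- receives the list containing the edge above w.
      · obtain ⟨⟨a, c, hac, ha, hc⟩, hall⟩ := nonTree_of_unrelated hT hv hw h h1 h2
        obtain ⟨c', hs, hc'⟩ := exists_selected_of_leaving hid hac hc
        have h3 := hall a c' hs.1 ha hc'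
        refine ⟨c', h3, h3.dep_sub_lt hv, by rwa [h3.iterate_eq], Or.inr (Or.inr
          ⟨a, T.dep a - T.dep w, hs.1.symm, hs, ha.dep_sub_lt hw, ?_, ?_⟩)⟩
        · rw [h3.iterate_eq, ha.iterate_eq, heq]
        · rw [h3.iterate_eq, ha.iterate_eq]
          exact hvw.symm
  · rw [circE_mk] at heq
    obtain ⟨v', hv', h1, h2⟩ := exists_ancestor_of_nonTree hac hT hsymm
    obtain rfl := treeEdge_injective hv hv' h1
    by_cases ha : T.Sub v a
    · exact ⟨a, ha, ha.dep_sub_lt hv, by rwa [ha.iterate_eq], Or.inr (Or.inl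
        ⟨c, hac, by rw [ha.iterate_eq, heq]⟩)⟩
    · have hc : T.Sub v c := by tauto
      exact ⟨c, hc, hc.dep_sub_lt hv, by rwa [hc.iterate_eq], Or.inr (Or.inl
        ⟨a, hac.symm, by rw [hc.iterate_eq, circ_comm, heq]⟩)⟩

/-- The value of the non-tree edge `{v, u}` occurs above `v`. -/
def OccursAbove (G : SimpleGraph V) (T : ParentTree V) (R : V → V → ℕ → ZMod 2) (v u : V) : Prop :=
  circ G T R v u ≠ 0 ∧ ∃ j, j < T.dep v ∧ up G T R (T.par^[j] v) = circ G T R v u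

theorem exists_isCutPair_of_occursAbove (hG : G.Connected) (hT : IsBfsTree G ident T)
    (hR : Generic G T R) (hn : NonTree G T v u) (h : OccursAbove G T R v u) :
    ∃ f, G.IsCutPair s(v, u) f := by
  obtain ⟨h0, j, hj, h⟩ := h
  have hw := iterate_ne_root hj
  exact ⟨s(T.par^[j] v, T.par (T.par^[j] v)), (hR.isCutPair_iff hG hT).mpr
    ⟨hn.ne_treeEdge hw, hn.1, hT.adj_par _ hw, by rw [circE_mk, circE_mk, circ_par hw, h], h0⟩⟩

/-- The partner is a tree edge above exactly one of the two ends. Only that end is certain to find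
the value among its ancestors, so labels must be exchanged at the end. -/
theorem nonTree_exists_isCutPair_iff (hG : G.Connected) (hT : IsBfsTree G ident T)
    (hR : Generic G T R) (hn : NonTree G T v u) :
    (∃ f, G.IsCutPair s(v, u) f) ↔ OccursAbove G T R v u ∨ OccursAbove G T R u v := by
  constructor
  · rintro ⟨f, hf⟩
    obtain ⟨-, -, -, heq, h0⟩ := (hR.isCutPair_iff hG hT).mp hf
    obtain ⟨w, hw, rfl, h2⟩ := exists_ancestor_of_nonTree hn hT hf
    rw [circE_mk] at h0
    rw [circE_mk, circE_mk, circ_par hw] at heq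
    by_cases hv : T.Sub w v
    · exact Or.inl ⟨h0, _, hv.dep_sub_lt hw, by rw [hv.iterate_eq, heq]⟩
    · have hu : T.Sub w u := by tauto
      rw [circ_comm] at h0 heq
      exact Or.inr ⟨h0, _, hu.dep_sub_lt hw, by rw [hu.iterate_eq, heq]⟩
  · rintro (h | h)
    · exact exists_isCutPair_of_occursAbove hG hT hR hn h
    · rw [Sym2.eq_swap]
      exact exists_isCutPair_of_occursAbove hG hT hR hn.symm h

section

variable (hid : Function.Injective ident) (hT : IsBfsTree G ident T)

include hid hT

theorem label_par (ht : 6 * T.height + 4 ≤ t) (hG : G.Connected) (hR : Generic G T RV)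
    (h : T.Child u v) : (W t v).label (ident u) =
      if ∃ f, G.IsCutPair s(v, u) f then some (natOf (vecLength V) (circE G T RV s(v, u)))
      else none := by
  have hdv := T.dep_le_height v
  have h1 := informed_of_le (v := v) (show 3 * T.height + 2 ≤ t by omega)
  have h2 : (∃ x, T.Sub v x ∧ Detects G T ident RV x (T.dep x - T.dep v)) ↔
      ∃ f, G.IsCutPair s(v, u) f := by
    rw [← h.2]
    constructor
    · rintro ⟨x, hx, hdx⟩
      have := exists_isCutPair_of_detects hG hT hR hdx
      rwa [hx.iterate_eq] at this
    · rintro ⟨f, hf⟩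
      exact exists_detects_of_isCutPair hid hG hT hR h.1 hf
  unfold View.label
  rw [if_pos ((isPar_iff hid hT (by omega)).mpr h), dist_eq hid hT (by omega),
    bits_eq hid hT h1, phi_eq hid hT (by omega), circE_mk, ← h.2, circ_par h.1]
  simp only [flag_iff hid hT (dep_pos h.1) le_rfl (show 6 * T.height + 4 + T.dep v ≤ t + T.dep v
    by omega), h2, h.2]

theorem label_kid (ht : 6 * T.height + 4 ≤ t) (h : T.Child v u) :
    (W t v).label (ident u) = none := by
  have hdv := T.dep_le_height v
  unfold View.label
  rw [if_neg, if_neg]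
  · rw [isNon_ident_iff hid hT (by omega)]
    exact fun h' => h'.1.2.2 h
  · rw [isPar_iff hid hT (by omega)]
    exact not_child_of_child h

theorem label_non (ht : 6 * T.height + 4 ≤ t) (h : NonTree G T v u) :
    (W t v).label (ident u) = if OccursAbove G T RV v u then
      some (natOf (vecLength V) (circE G T RV s(v, u))) else none := by
  have hdv := T.dep_le_height v
  have h1 := informed_of_le (v := v) (show 3 * T.height + 2 ≤ t by omega)
  have hu : ∀ x, up G T RV x ∈ vecs (vecLength V) := up_mem_vecs randVec_mem
  have hc : circ G T RV v u ∈ vecs (vecLength V) := circ_mem_vecs randVec_mem _ _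
  have key : (∃ j, (W t v).ancVal j = some (natOf (vecLength V) (circ G T RV v u))) ↔
      ∃ j, j < T.dep v ∧ up G T RV (T.par^[j] v) = circ G T RV v u := by
    refine exists_congr fun j => ?_
    by_cases hj : 4 * T.height + 4 + j ≤ t
    · rw [(anc_eq hid hT hj).2]
      split_ifs with h <;> simp [h, natOf_inj (hu _) hc]
    · unfold View.ancVal
      rw [if_neg (show j ≠ 0 by omega), listRound_eq hid hT h1, run_hist_of_le (by omega)]
      simp
      omega
  unfold View.label
  rw [if_neg (fun h' => h.2.1 ((isPar_iff hid hT (by omega)).mp h')), bits_eq hid hT h1,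
    nonVal_eq_circ hid hT (by omega) h, circE_mk]
  refine if_congr ?_ rfl rfl
  rw [key, isNon_ident_iff hid hT (by omega), Ne, natOf_eq_zero hc]
  exact ⟨fun h' => h'.2, fun h' => ⟨h, h'⟩⟩

/-- A tree edge is labelled by its lower end, a non-tree edge by whichever end finds a partner. If
both ends of a non-tree edge supply a label, the two agree because both are its value. -/
theorem output_eq (hG : G.Connected) (hR : Generic G T RV) (h : G.Adj v u) :
    (W (6 * T.height + 5) v).output (ident u) =
      if ∃ f, G.IsCutPair s(v, u) f then some (natOf (vecLength V) (circE G T RV s(v, u)))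
      else none := by
  have h1 := informed_of_le (v := v) (show 3 * T.height + 2 ≤ 6 * T.height + 5 by omega)
  have h2 := informed_of_le (v := u) (show 3 * T.height + 2 ≤ 6 * T.height + 4 by omega)
  unfold View.output
  rw [finalRound_eq hid hT h1, run_hist hid (by omega) h.symm]
  change ((W _ v).label _).or ((W _ u).outFin _) = _
  unfold View.outFin
  rw [if_pos ⟨(active_iff hid hT).mpr h2, by rw [run_t, finalRound_eq hid hT h2]⟩]
  by_cases hc : T.Child u v
  · rw [label_par hid hT (by omega) hG hR hc, label_kid hid hT le_rfl hc, Option.or_none]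
  · by_cases hc' : T.Child v u
    · rw [label_kid hid hT (by omega) hc', label_par hid hT le_rfl hG hR hc', Option.none_or,
        Sym2.eq_swap]
    · have hn : NonTree G T v u := ⟨h, hc, hc'⟩
      rw [label_non hid hT (by omega) hn, label_non hid hT le_rfl hn.symm, Sym2.eq_swap (a := u)]
      simp only [nonTree_exists_isCutPair_iff hG hT hR hn]
      by_cases h3 : OccursAbove G T RV v u <;> by_cases h4 : OccursAbove G T RV u v <;>
        simp [h3, h4]

theorem exists_labelling (hG : G.Connected) (hR : Generic G T RV) :
    ∃ lab : Sym2 V → Option ℕ, G.IsCutClassLabelling lab ∧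
      ∀ v u, G.Adj v u → (W (6 * T.height + 5) v).output (ident u) = lab s(v, u) := by
  refine ⟨fun e => if ∃ f, G.IsCutPair e f then some (natOf (vecLength V) (circE G T RV e))
    else none, ?_, fun v u h => output_eq hid hT hG hR h⟩
  refine isCutClassLabelling_of_iff (val := circE G T RV) (code := natOf (vecLength V))
    (fun e f => hR.isCutPair_iff hG hT) (fun e f => (natOf_inj (circE_mem_vecs randVec_mem e)
      (circE_mem_vecs randVec_mem f)).mp) fun e x _ => ?_
  split_ifs with h <;> simp [h]

end

end Closed

/-! ### Halting, messages and the main theorem -/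

section Closed

open Classical

variable {V : Type*} [Fintype V] {G : SimpleGraph V} {ident : V → ℕ} {T : ParentTree V}
  {ω : DistAlg.Coins V} {t : ℕ} {v u : V}

local notation "W" => run G ident T.root ω

local notation "RV" => randVec T ident ω

/-- Preorder numbers increase strictly along the path from the root, so they bound the depth; the
choice of key is irrelevant. -/
theorem ParentTree.dep_lt_card (T : ParentTree V) (v : V) : T.dep v < Fintype.card V := by
  refine lt_of_le_of_lt ?_ (pre_lt_card (T := T) (key := fun _ => 0) v)
  induction hd : T.dep v generalizing v with
  | zero => exact Nat.zero_le _
  | succ d ih =>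
    have hv : v ≠ T.root := fun h' => by rw [h', T.dep_root] at hd; omega
    have h1 := ih (T.par v) (by rw [dep_par_eq]; omega)
    have h2 := Child.pre_lt (T := T) (key := fun _ => 0) ⟨hv, rfl⟩
    omega

theorem ParentTree.height_lt_card (T : ParentTree V) : T.height < Fintype.card V :=
  (Finset.sup_lt_iff (by
    have := T.dep_lt_card T.root
    exact lt_of_le_of_lt (Nat.zero_le _) this)).mpr fun v _ => T.dep_lt_card v

theorem ParentTree.size_le_card (T : ParentTree V) (v : V) : T.size v ≤ Fintype.card V :=
  Finset.card_le_univ _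

theorem card_lt_two_pow_vecLength (hV : 1 < Fintype.card V) :
    Fintype.card V < 2 ^ vecLength V := by
  have h1 := Nat.le_pow_clog (one_lt_two) (Fintype.card V)
  have h2 := Nat.clog_pos one_lt_two hV
  refine h1.trans_lt (Nat.pow_lt_pow_right one_lt_two ?_)
  unfold vecLength
  omega

theorem lt_of_label {s : View} {x k : ℕ} (h : s.label x = some k) : k < 2 ^ s.bits := by
  unfold View.label at h
  split_ifs at h <;> (rw [Option.some_inj] at h; rw [← h]; exact natOf_lt _ _)

section

variable (hid : Function.Injective ident) (hT : IsBfsTree G ident T)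

include hid hT

/-- The halting round does not depend on v, as `config_eq_run` requires: before it, halting has no
effect on the execution. -/
theorem finished_iff (hne : ∃ u, G.Adj v u) : (W t v).finished ↔ 6 * T.height + 5 ≤ t := by
  have h1 : (W t v).nbrs ≠ ∅ := by
    obtain ⟨u, hu⟩ := hne
    exact Finset.ne_empty_of_mem (mem_run_nbrs.mpr ⟨u, hu, rfl⟩)
  unfold View.finished
  simp only [h1, false_or, active_iff hid hT, run_t]
  constructor
  · rintro ⟨h2, h3⟩
    rw [finalRound_eq hid hT h2] at h3
    omega
  · intro h
    have h2 := informed_of_le (v := v) (show 3 * T.height + 2 ≤ t by omega)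
    rw [finalRound_eq hid hT h2]
    exact ⟨h2, by omega⟩

/-- The occasions on which a vertex sends a message. -/
theorem occasion_of_out (hne : (W t v).out (ident u) ≠ fun _ => none) :
    t = T.dep v ∨ t = 3 * T.height + 3 ∨ t = 6 * T.height + 4 ∨ T.Child u v ∨ T.Child v u ∨
      Selected G T ident v u := by
  have hactive := fun h => (active_iff (ω := ω) (t := t) (v := v) hid hT).mp h
  have hpar : T.dep v ≤ t → (W t v).isPar (ident u) → T.Child u v := fun h =>
    (isPar_iff hid hT h).mp
  have hkid : T.dep v ≤ t → ident u ∈ (W t v).kids → T.Child v u := fun h =>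
    child_of_mem_kids hid hT h
  have hlst : (W t v).active ∧ (W t v).listRound ≤ (W t v).t ∧
      (ident u ∈ (W t v).kids ∨ (W t v).selected (ident u)) →
      T.Child v u ∨ Selected G T ident v u := by
    rintro ⟨h1, h2, h3⟩
    have h1 := hactive h1
    rw [run_t, listRound_eq hid hT h1] at h2
    exact h3.imp (hkid (by omega)) (selected_iff hid hT (by omega)).mp
  by_contra! hno
  obtain ⟨n1, n2, n3, n4, n5, n6⟩ := hno
  refine hne (funext fun ch => ?_)
  have c0 : (W t v).outBfs (ident u) = none :=
    Option.not_isSome_iff_eq_none.mp fun h => n1 ((outBfs_isSome hid hT _ _ _).mp h).symm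
  have c1 : (W t v).outEcho (ident u) = none := if_neg fun h =>
    n4 (hpar ((known_iff hid hT).mp h.2.1) h.1)
  have c2 : (W t v).outN (ident u) = none := by
    unfold View.outN
    split_ifs with h
    · by_cases ha : 2 * T.height + 2 + T.dep v ≤ t
      · exact absurd (hkid (by omega) h) n5
      · exact numV_eq_none hid hT ha
    · rfl
  have c3 : (W t v).outPre (ident u) = none := if_neg fun h =>
    n5 (hkid (by have := hactive h.2; omega) h.1)
  have c4 : (W t v).outH (ident u) = none := if_neg fun h =>
    n5 (hkid (by have := hactive h.2; omega) h.1)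
  have hbase : ¬ ((W t v).active ∧ (W t v).t = (W t v).base + 1) := fun h => n2 (by
    have h2 := h.2
    rwa [run_t, base_eq hid hT (hactive h.1)] at h2)
  have c5 : (W t v).outExPre (ident u) = none := if_neg hbase
  have c6 : (W t v).outExVal (ident u) = none := if_neg hbase
  have c7 : (W t v).outUp (ident u) = none := if_neg fun h =>
    n4 (hpar (by have := hactive h.1; omega) h.2.1)
  have c8 : (W t v).outLstPre (ident u) = none := if_neg fun h => (hlst h).elim n5 n6
  have c9 : (W t v).outLstVal (ident u) = none := if_neg fun h => (hlst h).elim n5 n6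
  have c10 : (W t v).outFlag (ident u) = none := if_neg fun h =>
    n4 (hpar (by have := hactive h.1; omega) h.2.1)
  have c11 : (W t v).outFin (ident u) = none := if_neg fun h => n3 (by
    have h2 := h.2
    rwa [run_t, finalRound_eq hid hT (hactive h.1)] at h2)
  fin_cases ch <;> assumption

/-- Every number sent is a count, a height, a preorder number, a flag or a coded vector. IDs are
never transmitted, so the final message bound does not depend on the range of the IDs. -/
theorem out_lt (hV : 1 < Fintype.card V) (ch : Fin channels) (k : ℕ)
    (hk : k ∈ (W t v).out (ident u) ch) : k < 2 ^ vecLength V := by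
  have hn := card_lt_two_pow_vecLength hV
  have hsmall : ∀ m, m < Fintype.card V → m < 2 ^ vecLength V := fun m hm => hm.trans hn
  have hactive := fun h => (active_iff (ω := ω) (t := t) (v := v) hid hT).mp h
  have hnat : (W t v).active → ∀ f, natOf (W t v).bits f < 2 ^ vecLength V := fun h f => by
    rw [← bits_eq hid hT (hactive h)]
    exact natOf_lt _ _
  have c0 : (W t v).outBfs (ident u) = some k → k < 2 ^ vecLength V := by
    unfold View.outBfs
    intro h
    split_ifs at h <;> (rw [Option.some_inj] at h; omega)
  have c1 : (W t v).outEcho (ident u) = some k → k < 2 ^ vecLength V := by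
    unfold View.outEcho
    intro h
    split_ifs at h with h1
    rw [run_t] at h1
    rw [(size_eq_of_ready hid hT ((ready_iff hid hT le_rfl).mp h1.2)).1, Option.some_inj] at h
    have := T.size_le_card v
    omega
  have c2 : (W t v).outN (ident u) = some k → k < 2 ^ vecLength V := by
    unfold View.outN
    intro h
    split_ifs at h with h1
    by_cases ha : 2 * T.height + 2 + T.dep v ≤ t
    · rw [numV_eq_some hid hT ha, Option.some_inj] at h
      omega
    · rw [numV_eq_none hid hT ha] at h
      cases h
  have c3 : (W t v).outPre (ident u) = some k → k < 2 ^ vecLength V := by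
    intro h
    by_cases h1 : ident u ∈ (W t v).kids ∧ (W t v).active
    · have h2 := hactive h1.2
      rw [outPre_eq hid hT h2 (number_eq hid hT h2) (child_of_mem_kids hid hT (by omega) h1.1),
        Option.some_inj] at h
      exact h ▸ hsmall _ (pre_lt_card u)
    · unfold View.outPre at h
      rw [if_neg h1] at h
      cases h
  have c4 : (W t v).outH (ident u) = some k → k < 2 ^ vecLength V := by
    unfold View.outH
    intro h
    split_ifs at h with h1
    rw [height_eq hid hT (hactive h1.2), Option.some_inj] at h
    exact h ▸ hsmall _ T.height_lt_card
  have c5 : (W t v).outExPre (ident u) = some k → k < 2 ^ vecLength V := by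
    unfold View.outExPre
    intro h
    split_ifs at h with h1
    rw [number_eq hid hT (hactive h1.1), Option.some_inj] at h
    exact h ▸ hsmall _ (pre_lt_card v)
  have c6 : (W t v).outExVal (ident u) = some k → k < 2 ^ vecLength V := by
    unfold View.outExVal
    intro h
    split_ifs at h with h1
    exact Option.some_inj.mp h ▸ hnat h1.1 _
  have c7 : (W t v).outUp (ident u) = some k → k < 2 ^ vecLength V := by
    unfold View.outUp
    intro h
    split_ifs at h with h1
    exact Option.some_inj.mp h ▸ hnat h1.1 _
  have c8 : (W t v).outLstPre (ident u) = some k → k < 2 ^ vecLength V := by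
    unfold View.outLstPre
    intro h
    split_ifs at h with h1
    have h2 := hactive h1.1
    have h3 := h1.2.1
    rw [run_t, listRound_eq hid hT h2] at h3
    rw [run_t, listRound_eq hid hT h2, (anc_eq hid hT (by omega)).1] at h
    split_ifs at h
    exact Option.some_inj.mp h ▸ hsmall _ (pre_lt_card _)
  have c9 : (W t v).outLstVal (ident u) = some k → k < 2 ^ vecLength V := by
    unfold View.outLstVal
    intro h
    split_ifs at h with h1
    have h2 := hactive h1.1
    have h3 := h1.2.1
    rw [run_t, listRound_eq hid hT h2] at h3
    rw [run_t, listRound_eq hid hT h2, (anc_eq hid hT (by omega)).2] at h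
    split_ifs at h
    exact Option.some_inj.mp h ▸ natOf_lt _ _
  have c10 : (W t v).outFlag (ident u) = some k → k < 2 ^ vecLength V := by
    unfold View.outFlag
    intro h
    split_ifs at h with h1
    rw [Option.some_inj] at h
    omega
  have c11 : (W t v).outFin (ident u) = some k → k < 2 ^ vecLength V := by
    unfold View.outFin
    intro h
    split_ifs at h with h1
    rw [← bits_eq hid hT (hactive h1.1)]
    exact lt_of_label h
  have hk : (W t v).out (ident u) ch = some k := hk
  fin_cases ch
  exacts [c0 hk, c1 hk, c2 hk, c3 hk, c4 hk, c5 hk, c6 hk, c7 hk, c8 hk, c9 hk, c10 hk, c11 hk]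

end

/-- The number of ways in which `v` is linked to `u` by a tree edge or by the choice of an edge
for the list of ancestors. -/
noncomputable def links (G : SimpleGraph V) (T : ParentTree V) (ident : V → ℕ) (v u : V) : ℕ :=
  (if T.Child u v then 1 else 0) + (if T.Child v u then 1 else 0) +
    (if NonTree G T v u ∧ ∀ w, NonTree G T v w → T.pre ident u ≤ T.pre ident w then 1 else 0) +
    (if NonTree G T v u ∧ ∀ w, NonTree G T v w → T.pre ident w ≤ T.pre ident u then 1 else 0)

theorem sum_indicator_le_one {p : V → Prop} [DecidablePred p] (h : ∀ u u', p u → p u' → u = u') :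
    ∑ u, (if p u then 1 else 0) ≤ 1 := by
  rw [Finset.sum_boole, Nat.cast_id, Finset.card_le_one]
  intro u hu u' hu'
  exact h u u' (by simpa using hu) (by simpa using hu')

/-- A vertex has at most one parent, and injectivity of the preorder numbers leaves at most one
smallest and one largest non-tree neighbour. Children are counted by exchanging the sums. -/
theorem sum_links_le (hid : Function.Injective ident) :
    ∑ v, ∑ u, links G T ident v u ≤ 4 * Fintype.card V := by
  have hone : ∀ {p : V → V → Prop} [∀ v u, Decidable (p v u)], (∀ v u u', p v u → p v u' → u = u') →
      ∑ v, ∑ u, (if p v u then 1 else 0) ≤ Fintype.card V := by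
    intro p _ hp
    refine (Finset.sum_le_sum fun v _ => sum_indicator_le_one (hp v)).trans ?_
    simp
  unfold links
  simp only [Finset.sum_add_distrib]
  have h1 := hone (p := fun v u => T.Child u v) fun v u u' h h' => h.2.symm.trans h'.2
  have h2 : ∑ v, ∑ u, (if T.Child v u then 1 else 0) ≤ Fintype.card V := by
    rw [Finset.sum_comm]
    exact h1
  have h3 := hone (p := fun v u => NonTree G T v u ∧
      ∀ w, NonTree G T v w → T.pre ident u ≤ T.pre ident w) fun v u u' h h' =>
    pre_injective hid (le_antisymm (h.2 u' h'.1) (h'.2 u h.1))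
  have h4 := hone (p := fun v u => NonTree G T v u ∧
      ∀ w, NonTree G T v w → T.pre ident w ≤ T.pre ident u) fun v u u' h h' =>
    pre_injective hid (le_antisymm (h'.2 u h.1) (h.2 u' h'.1))
  omega

theorem one_le_links (h : T.Child u v ∨ T.Child v u ∨ Selected G T ident v u) :
    1 ≤ links G T ident v u := by
  unfold links
  rcases h with h | h | ⟨h1, h | h⟩
  · rw [if_pos h]; omega
  · rw [if_pos (c := T.Child v u) h]; omega
  · rw [if_pos (c := _ ∧ ∀ w, NonTree G T v w → T.pre ident u ≤ T.pre ident w) ⟨h1, h⟩]; omega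
  · rw [if_pos (c := _ ∧ ∀ w, NonTree G T v w → T.pre ident w ≤ T.pre ident u) ⟨h1, h⟩]; omega

/-- The random vectors are generic with high probability. -/
theorem measure_generic_ge (hid : Function.Injective ident) (hV : 1 < Fintype.card V)
    {A : Set (DistAlg.Coins V)} (hA : ∀ ω, Generic G T (randVec T ident ω) → ω ∈ A) :
    1 - 1 / (Fintype.card V : ℝ) ≤ (DistAlg.coinMeasure V).real A := by
  -- Bad events are indexed by all quadruples of vertices; those not describing a connected deletion
  -- of edges are empty.
  have h1 : ∀ p : (V × V) × V × V, DistAlg.coinMeasure V {ω |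
      s(p.1.1, p.1.2) ∈ G.edgeSet ∧ s(p.2.1, p.2.2) ∈ G.edgeSet ∧
      (G.deleteEdges {s(p.1.1, p.1.2), s(p.2.1, p.2.2)}).Connected ∧
      ∑ x ∈ ({s(p.1.1, p.1.2), s(p.2.1, p.2.2)} : Finset (Sym2 V)),
        circE G T (randVec T ident ω) x = 0} * 2 ^ vecLength V ≤ 1 := by
    intro p
    by_cases h : s(p.1.1, p.1.2) ∈ G.edgeSet ∧ s(p.2.1, p.2.2) ∈ G.edgeSet ∧
      (G.deleteEdges {s(p.1.1, p.1.2), s(p.2.1, p.2.2)}).Connected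
    · obtain ⟨he, hf, hc⟩ := h
      have hsub : ↑({s(p.1.1, p.1.2), s(p.2.1, p.2.2)} : Finset (Sym2 V)) ⊆ G.edgeSet := by
        rw [Finset.coe_pair]
        exact Set.insert_subset he (Set.singleton_subset_iff.mpr hf)
      obtain ⟨a, c, hac⟩ := exists_coeff_eq_one (T := T) hsub (by simp)
        (by rw [Finset.coe_pair]; exact hc)
      simp only [he, hf, hc, true_and, sum_circE_eq_sum hsub]
      exact measure_linear_eq_zero_le (3 * T.height + 2) (vecLength V) hid _ hac
    · have : {ω : DistAlg.Coins V | s(p.1.1, p.1.2) ∈ G.edgeSet ∧ s(p.2.1, p.2.2) ∈ G.edgeSet ∧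
          (G.deleteEdges {s(p.1.1, p.1.2), s(p.2.1, p.2.2)}).Connected ∧
          ∑ x ∈ ({s(p.1.1, p.1.2), s(p.2.1, p.2.2)} : Finset (Sym2 V)),
            circE G T (randVec T ident ω) x = 0} = ∅ := by
        rw [Set.eq_empty_iff_forall_notMem]
        exact fun ω hω => h ⟨hω.1, hω.2.1, hω.2.2.1⟩
      rw [this]
      simp
  have h2 := one_sub_le_measureReal h1 (A := A) fun ω hω => hA ω fun e he f hf hc h0 => by
    induction e with
    | h a c =>
      induction f with
      | h a' c' => exact hω ((a, c), (a', c')) ⟨he, hf, hc, h0⟩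
  refine le_trans ?_ h2
  have hn : (0 : ℝ) < Fintype.card V := by exact_mod_cast (zero_lt_one.trans hV)
  -- The factor 5 in the vector length pays for n^4 events and a remaining probability of 1/n.
  have h3 : (Fintype.card V : ℝ) ^ 5 ≤ 2 ^ vecLength V := by
    have := Nat.pow_le_pow_left (Nat.le_pow_clog one_lt_two (Fintype.card V)) 5
    rw [← pow_mul, mul_comm] at this
    exact_mod_cast this
  have h4 : (Fintype.card ((V × V) × V × V) : ℝ) = (Fintype.card V : ℝ) ^ 4 := by
    simp only [Fintype.card_prod]
    push_cast
    ring
  rw [h4]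
  refine sub_le_sub_left ?_ 1
  rw [div_le_div_iff₀ (by positivity) hn]
  linarith [show (Fintype.card V : ℝ) ^ 4 * Fintype.card V = (Fintype.card V : ℝ) ^ 5 by ring]

end Closed

/-! ### Running time, message size and message complexity of the halting program. -/

section Main

open Classical

variable {V : Type*} [Fintype V] {G : SimpleGraph V} {ident : V → ℕ} {T : ParentTree V}
  {ω : DistAlg.Coins V} {t : ℕ} {v u : V}

local notation "W" => run G ident T.root ω

omit [Fintype V] in
theorem exists_adj_of_connected (hG : G.Connected) [Nontrivial V] (v : V) : ∃ u, G.Adj v u := by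
  obtain ⟨w, hw⟩ := exists_ne v
  obtain ⟨p⟩ := hG.preconnected v w
  cases p with
  | nil => exact absurd rfl hw
  | cons h _ => exact ⟨_, h⟩

section

variable (hid : Function.Injective ident) (hT : IsBfsTree G ident T)
  (hadj : ∀ v, ∃ u, G.Adj v u)

include hid hT hadj

theorem config_of_le (h : t ≤ 6 * T.height + 5) :
    cutClassProgram.config G ident T.root ω t = W t :=
  config_eq_run _ (fun q hq v => decide_eq_false fun h' => by
    have := (finished_iff hid hT (hadj v)).mp h'
    omega) h

theorem config_of_ge (h : 6 * T.height + 5 ≤ t) :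
    cutClassProgram.config G ident T.root ω t = W (6 * T.height + 5) :=
  config_eq_run_end _ (fun q hq v => decide_eq_false fun h' => by
    have := (finished_iff hid hT (hadj v)).mp h'
    omega) (fun v => decide_eq_true ((finished_iff hid hT (hadj v)).mpr le_rfl)) h

theorem haltsWithin (h : 6 * T.height + 5 ≤ t) :
    cutClassProgram.HaltsWithin G ident T.root ω t := fun v => by
  rw [config_of_ge hid hT hadj h]
  exact decide_eq_true ((finished_iff hid hT (hadj v)).mpr le_rfl)

theorem message_eq_some {m : List Bool}
    (h : cutClassProgram.message G ident T.root ω t v u = some m) :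
    t < 6 * T.height + 5 ∧ G.Adj v u ∧ pack ((W t v).out (ident u)) = some m := by
  unfold DistAlg.message DistAlg.sent at h
  split_ifs at h with h1
  have ht : t < 6 * T.height + 5 := by
    by_contra hge
    have := haltsWithin hid hT hadj (not_lt.mp hge) v (ω := ω)
    rw [h1.2] at this
    exact Bool.noConfusion this
  rw [config_of_le hid hT hadj ht.le] at h
  exact ⟨ht, h1.1, h⟩

theorem length_message_le (hV : 1 < Fintype.card V) {m : List Bool}
    (h : cutClassProgram.message G ident T.root ω t v u = some m) :
    m.length ≤ 156 * Nat.clog 2 (Fintype.card V) := by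
  obtain ⟨-, -, h⟩ := message_eq_some hid hT hadj h
  unfold pack at h
  split_ifs at h
  rw [Option.some_inj] at h
  have h1 := length_encode_le (out_lt (ω := ω) (t := t) (v := v) (u := u) hid hT hV)
  -- With L = ⌈log₂ n⌉ ≥ 1, the bound is 12(2(5L + 1) + 1) = 120L + 36 ≤ 156L.
  have h2 := Nat.clog_pos one_lt_two hV
  rw [h] at h1
  unfold vecLength channels at h1
  omega

theorem isSome_message_le :
    (if (cutClassProgram.message G ident T.root ω t v u).isSome then 1 else 0) ≤
      if t < 6 * T.height + 5 ∧ G.Adj v u then 1 else 0 := by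
  split_ifs with h1 h2
  · exact le_rfl
  · obtain ⟨m, hm⟩ := Option.isSome_iff_exists.mp h1
    have := message_eq_some hid hT hadj hm
    exact absurd ⟨this.1, this.2.1⟩ h2
  · exact zero_le_one
  · exact le_rfl

theorem isSome_message_le_links :
    (if (cutClassProgram.message G ident T.root ω t v u).isSome then 1 else 0) ≤
      (if t = T.dep v then 1 else 0) + (if t = 3 * T.height + 3 then 1 else 0) +
        (if t = 6 * T.height + 4 then 1 else 0) +
        if t < 6 * T.height + 5 then links G T ident v u else 0 := by
  by_cases h1 : (cutClassProgram.message G ident T.root ω t v u).isSome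
  · rw [if_pos h1]
    obtain ⟨m, hm⟩ := Option.isSome_iff_exists.mp h1
    obtain ⟨ht, -, hm⟩ := message_eq_some hid hT hadj hm
    have hne : (W t v).out (ident u) ≠ fun _ => none := by
      intro h
      rw [h] at hm
      simp [pack] at hm
    rw [if_pos (c := t < 6 * T.height + 5) ht]
    rcases occasion_of_out hid hT hne with h | h | h | h
    · rw [if_pos (c := t = T.dep v) h]; omega
    · rw [if_pos (c := t = 3 * T.height + 3) h]; omega
    · rw [if_pos (c := t = 6 * T.height + 4) h]; omega
    · have := one_le_links h
      omega
  · rw [if_neg h1]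
    exact Nat.zero_le _

omit hid hT hadj in
theorem sum_range_lt_le (N E l : ℕ) : ∑ t ∈ Finset.range N, (if t < E then l else 0) ≤ E * l := by
  rw [← Finset.sum_filter, Finset.sum_const, smul_eq_mul]
  refine Nat.mul_le_mul_right _ ?_
  calc _ ≤ (Finset.range E).card := Finset.card_le_card fun t ht => by
        simp only [Finset.mem_filter, Finset.mem_range] at ht ⊢
        exact ht.2
    _ = E := Finset.card_range E

omit hid hT hadj in
theorem sum_range_eq_le (N c : ℕ) : ∑ t ∈ Finset.range N, (if t = c then 1 else 0) ≤ 1 := by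
  rw [Finset.sum_ite_eq']
  split_ifs <;> omega

omit hid hT hadj in
theorem sum_adj_eq : ∑ v, ∑ u, (if G.Adj v u then 1 else 0) = 2 * G.edgeSet.ncard := by
  rw [Set.ncard_eq_toFinset_card', Set.toFinset_card, ← SimpleGraph.edgeFinset_card,
    ← G.sum_degrees_eq_twice_card_edges]
  refine Finset.sum_congr rfl fun v _ => ?_
  rw [Finset.sum_boole, Nat.cast_id, ← SimpleGraph.card_neighborFinset_eq_degree]
  congr 1
  ext u
  simp

theorem messageCount_le_edges (N : ℕ) : cutClassProgram.messageCount G ident T.root ω N ≤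
    (6 * T.height + 5) * (2 * G.edgeSet.ncard) := by
  unfold DistAlg.messageCount
  refine (Finset.sum_le_sum fun t _ => Finset.sum_le_sum fun v _ => Finset.sum_le_sum fun u _ =>
    isSome_message_le hid hT hadj).trans ?_
  rw [← sum_adj_eq]
  refine le_trans (Finset.sum_le_sum fun t _ => ?_) (sum_range_lt_le N _ _)
  split_ifs with h <;> simp [h]

/-- Each ordered pair pays for the three global exchanges (announcement, random vectors, labels),
giving 3n². All other messages follow the at most 4n links, in each of 6h + 5 rounds. -/
theorem messageCount_le_card (N : ℕ) : cutClassProgram.messageCount G ident T.root ω N ≤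
    3 * Fintype.card V ^ 2 + (6 * T.height + 5) * (4 * Fintype.card V) := by
  unfold DistAlg.messageCount
  refine (Finset.sum_le_sum fun t _ => Finset.sum_le_sum fun v _ => Finset.sum_le_sum fun u _ =>
    isSome_message_le_links hid hT hadj).trans ?_
  have h1 : ∀ v u, ∑ t ∈ Finset.range N, ((if t = T.dep v then 1 else 0) +
      (if t = 3 * T.height + 3 then 1 else 0) + (if t = 6 * T.height + 4 then 1 else 0) +
        if t < 6 * T.height + 5 then links G T ident v u else 0) ≤
      3 + (6 * T.height + 5) * links G T ident v u := by
    intro v u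
    simp only [Finset.sum_add_distrib]
    have := sum_range_eq_le N (T.dep v)
    have := sum_range_eq_le N (3 * T.height + 3)
    have := sum_range_eq_le N (6 * T.height + 4)
    have := sum_range_lt_le N (6 * T.height + 5) (links G T ident v u)
    omega
  rw [Finset.sum_comm]
  calc _ = ∑ v, ∑ u, ∑ t ∈ Finset.range N, ((if t = T.dep v then 1 else 0) +
      (if t = 3 * T.height + 3 then 1 else 0) + (if t = 6 * T.height + 4 then 1 else 0) +
        if t < 6 * T.height + 5 then links G T ident v u else 0) :=
        Finset.sum_congr rfl fun v _ => Finset.sum_comm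
    _ ≤ ∑ v, ∑ u, (3 + (6 * T.height + 5) * links G T ident v u) :=
        Finset.sum_le_sum fun v _ => Finset.sum_le_sum fun u _ => h1 v u
    _ = 3 * Fintype.card V ^ 2 + (6 * T.height + 5) * ∑ v, ∑ u, links G T ident v u := by
        simp only [Finset.sum_add_distrib, Finset.mul_sum]
        simp
        ring
    _ ≤ _ := Nat.add_le_add_left (Nat.mul_le_mul_left _ (sum_links_le hid)) _

theorem computesCutClasses (hG : G.Connected) (hR : Generic G T (randVec T ident ω))
    (h : 6 * T.height + 5 ≤ t) : cutClassProgram.ComputesCutClasses G ident T.root ω t := by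
  obtain ⟨lab, h1, h2⟩ := exists_labelling hid hT hG hR
  refine ⟨lab, h1, fun v u hvu => ?_⟩
  rw [config_of_ge hid hT hadj h]
  exact h2 v u hvu

end

end Main

end CutClasses

open CutClasses in
theorem mainTheorem7 :
    ∃ (A : DistAlg) (C : ℕ), ∀ a : ℕ, ∃ B : ℕ,
      ∀ (V : Type*) [Fintype V] (G : SimpleGraph V), G.Connected →
      ∀ (ident : V → ℕ), Function.Injective ident →
        (∀ v, ident v < 2 ^ (a * Nat.clog 2 (Fintype.card V))) →
      ∀ r : V,
        (∀ ω : DistAlg.Coins V,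
          A.HaltsWithin G ident r ω (C * G.diam) ∧
          A.messageCount G ident r ω (C * G.diam) ≤
            C * min (G.edgeSet.ncard * G.diam) (Fintype.card V ^ 2) ∧
          ∀ (t : ℕ) (v u : V) (m : List Bool), A.message G ident r ω t v u = some m →
            m.length ≤ B * Nat.clog 2 (Fintype.card V)) ∧
        1 - 1 / (Fintype.card V : ℝ) ≤
          (DistAlg.coinMeasure V).real
            {ω | A.ComputesCutClasses G ident r ω (C * G.diam)} := by
  classical
  -- The constant 27 = 3 + 6 · 4 comes from the bound in terms of n², where 6h + 5 ≤ 6n. The bound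
  -- in terms of edges needs only 22, and the time only 11.
  refine ⟨cutClassProgram, 27, fun a => ⟨156, fun V _ G hG ident hid _ r => ?_⟩⟩
  have hne : Nonempty V := ⟨r⟩
  rcases subsingleton_or_nontrivial V with hV | hV
  · have hcard : Fintype.card V = 1 := Fintype.card_eq_one_iff.mpr ⟨r, fun y => hV.elim y r⟩
    have hD : G.diam = 0 := SimpleGraph.diam_eq_zero.mpr (Or.inr hV)
    rw [hcard, hD]
    -- A single vertex has diameter 0 and must halt at once, which the clause on an empty
    -- neighbourhood in `View.finished` ensures. The required probability is 0.
    refine ⟨fun ω => ⟨fun v => decide_eq_true (Or.inl ?_), ?_, fun t v u m h => ?_⟩, by simp⟩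
    · rw [Finset.eq_empty_iff_forall_notMem]
      intro x hx
      rw [Nat.mul_zero] at hx
      have hx : x ∈ (run G ident r ω 0 v).nbrs := hx
      obtain ⟨u, hu, -⟩ := mem_run_nbrs.mp hx
      exact hu.ne (hV.elim v u)
    · simp [DistAlg.messageCount]
    · unfold DistAlg.message DistAlg.sent at h
      split_ifs at h with h1
      exact absurd (hV.elim v u) h1.1.ne
  · have hcard : 1 < Fintype.card V := Fintype.one_lt_card
    have htop : G.ediam ≠ ⊤ := SimpleGraph.connected_iff_ediam_ne_top.mp hG
    have hD : G.diam ≠ 0 := SimpleGraph.diam_ne_zero_of_ediam_ne_top htop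
    obtain ⟨T, rfl, hdep, hT⟩ := exists_isBfsTree hG ident r
    have hadj := exists_adj_of_connected hG
    have hh : T.height ≤ G.diam := Finset.sup_le fun v _ => by
      rw [hdep]
      exact SimpleGraph.dist_le_diam htop
    -- The additive 5 is absorbed because the diameter is at least 1.
    have hE : 6 * T.height + 5 ≤ 27 * G.diam := by omega
    refine ⟨fun ω => ⟨haltsWithin hid hT hadj hE, ?_, fun t v u m h =>
      length_message_le hid hT hadj hcard h⟩, measure_generic_ge hid hcard fun ω hω =>
        computesCutClasses hid hT hadj hG hω hE⟩
    rw [← Nat.mul_min_mul_left, le_min_iff]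
    constructor
    · refine (messageCount_le_edges hid hT hadj _).trans ?_
      have : 6 * T.height + 5 ≤ 11 * G.diam := by omega
      nlinarith [Nat.mul_le_mul_right G.edgeSet.ncard this]
    · refine (messageCount_le_card hid hT hadj _).trans ?_
      have := T.height_lt_card
      have : 6 * T.height + 5 ≤ 6 * Fintype.card V := by omega
      nlinarith [Nat.mul_le_mul_right (Fintype.card V) this]
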